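/- A plane binary tree is either the trivial tree $|$ (one leaf, no internal vertex) or is of the form $A\vee B$, where $A$ (left) and $B$ (right) are plane binary trees grafted on the two leaves of the tree with one internal vertex. Let $Y_n$ be the set of plane binary trees with $n$ internal vertices (hence $n+1$ leaves). The Tamari order on $Y_n$ is defined by: $S\le T$ if $T$ can be obtained from $S$ by a (possibly empty) sequence of local replacements of a configuration $A\vee(B\vee C)$ by $(A\vee B)\vee C$. An interval of $Y_n$ is a pair $[S,T]$ with $S\le T$ in $Y_n$. A plane tree is a rooted planar tree in which every internal vertex $s$ has at least two ordered children; write $v(s)\ge 3$ for its valence (number of children plus one). Given a plane tree $P$ with $n+1$ leaves and, for every internal vertex $s$ of $P$, an interval $I_s$ of $Y_{v(s)-2}$, let $G(P,(I_s)_s)$ be the interval of $Y_n$ whose minimum (respectively maximum) is obtained by grafting the minima (respectively maxima) of the $I_s$ along $P$, that is, by replacing each internal vertex $s$ of $P$ by the corresponding binary tree, whose $v(s)-1$ leaves receive, from left to right, what is grafted on the children of $s$. An interval is called new if it is not of the form $G(P,(I_s)_s)$ with $P$ having at least two internal vertices. Let $N_n$ be the number of new intervals of $Y_n$. Theorem.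 For every $n\ge 2$, $$N_n = 3\,\frac{2^{n-2}\,(2n-2)!}{(n-1)!\,(n+1)!}.$$ Moreover, the generating function $\nu=\sum_{n\ge 1} N_n\,y^{n+1}\in\mathbb{Q}[[y]]$ satisfies $$16\nu^2-(-1+12y+8y^2)\,\nu-y^2+11y^3+y^4=0.$$ -/

import Mathlib

open scoped Nat

namespace Tamari

/-- A planar binary tree: `BinaryTree.nil` is the trivial tree (a single leaf), and
`BinaryTree.node () l r` grafts `l` on the left leaf and `r` on the right leaf of the
one-vertex tree. `numNodes` counts internal vertices. -/
abbrev BTree : Type := BinaryTree Unit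

/-- `Rotates S T`: the tree `T` is obtained from `S` by replacing locally one
right-comb configuration `A ∨ (B ∨ C)` by the left-comb configuration `(A ∨ B) ∨ C`. -/
inductive Rotates : BTree → BTree → Prop
  | rotate (A B C : BTree) :
      Rotates (.node () A (.node () B C)) (.node () (.node () A B) C)
  | left {A A' : BTree} (B : BTree) (h : Rotates A A') :
      Rotates (.node () A B) (.node () A' B)
  | right (A : BTree) {B B' : BTree} (h : Rotates B B') :
      Rotates (.node () A B) (.node () A B')

/-- Auxiliary statistic used only to show that the Tamari order is antisymmetric. -/
def rightWeight : BTree → ℕ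
  | .nil => 0
  | .node _ l r => rightWeight l + rightWeight r + r.numNodes

theorem Rotates.numNodes_eq {S T : BTree} (h : Rotates S T) : S.numNodes = T.numNodes := by
  induction h with
  | rotate A B C => simp only [BinaryTree.numNodes]; omega
  | left B h ih => simp only [BinaryTree.numNodes]; omega
  | right A h ih => simp only [BinaryTree.numNodes]; omega

theorem Rotates.rightWeight_lt {S T : BTree} (h : Rotates S T) :
    rightWeight T < rightWeight S := by
  induction h with
  | rotate A B C => simp only [rightWeight, BinaryTree.numNodes]; omega
  | left B h ih => simp only [rightWeight]; omega
  | right A h ih => have := h.numNodes_eq; simp only [rightWeight]; omega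

theorem eq_or_rightWeight_lt {S T : BTree} (h : Relation.ReflTransGen Rotates S T) :
    S = T ∨ rightWeight T < rightWeight S := by
  induction h with
  | refl => exact Or.inl rfl
  | tail _ hr ih =>
    have := hr.rightWeight_lt
    rcases ih with rfl | ih
    · exact Or.inr this
    · exact Or.inr (this.trans ih)

/-- The set `Y_n` of planar binary trees with `n` internal vertices. -/
def Y (n : ℕ) : Type := {t : BTree // t.numNodes = n}

/-- The Tamari order on `Y_n`: `S ≤ T` when `T` can be reached from `S` by a (possibly
empty) sequence of local replacements of the right comb by the left comb. -/
instance (n : ℕ) : PartialOrder (Y n) where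
  le S T := Relation.ReflTransGen Rotates S.1 T.1
  le_refl _ := Relation.ReflTransGen.refl
  le_trans _ _ _ h₁ h₂ := Relation.ReflTransGen.trans h₁ h₂
  le_antisymm S T h₁ h₂ := by
    rcases eq_or_rightWeight_lt h₁ with h | h
    · exact Subtype.ext h
    · rcases eq_or_rightWeight_lt h₂ with h' | h'
      · exact Subtype.ext h'.symm
      · omega

/-- The set of (nonempty) intervals `[S, T]`, `S ≤ T`, of the Tamari lattice `Y_n`;
`I.fst` is the minimum and `I.snd` the maximum. -/
abbrev Interval (n : ℕ) : Type := NonemptyInterval (Y n)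

/-- A plane tree: either the trivial tree (a single leaf), or a bottom internal vertex with
an ordered list of `m + 2 ≥ 2` subtrees above it (that vertex has valence `m + 3`,
counting the edge below it). -/
inductive PlaneTree : Type
  | leaf : PlaneTree
  | node (m : ℕ) (child : Fin (m + 2) → PlaneTree) : PlaneTree

/-- The internal vertices of a plane tree. -/
inductive InternalVertex : PlaneTree → Type
  | root (m : ℕ) (child : Fin (m + 2) → PlaneTree) : InternalVertex (.node m child)
  | above (m : ℕ) (child : Fin (m + 2) → PlaneTree) (i : Fin (m + 2))
      (s : InternalVertex (child i)) : InternalVertex (.node m child)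

/-- The number `v(s) - 2`, where `v(s)` is the valence of the internal vertex `s`. -/
def InternalVertex.rank : {P : PlaneTree} → InternalVertex P → ℕ
  | _, .root m _ => m + 1
  | _, .above _ _ _ s => s.rank

/-- Graft the trees `f 0, f 1, …` on the leaves of a binary tree, from left to right. -/
def graftLeaves : (t : BTree) → (Fin t.numLeaves → BTree) → BTree
  | .nil, f => f (0 : Fin 1)
  | .node _ l r, f =>
      .node () (graftLeaves l fun i => f (Fin.castAdd r.numLeaves i))
        (graftLeaves r fun i => f (Fin.natAdd l.numLeaves i))

theorem numLeaves_of_mem {m : ℕ} (t : Y (m + 1)) : t.1.numLeaves = m + 2 := by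
  rw [BinaryTree.numLeaves_eq_numNodes_succ, t.2]

/-- Grafting along a plane tree `P`: given a binary tree in `Y_{v(s)-2}` (so with `v(s) - 1`
leaves) for each internal vertex `s` of `P`, replace every internal vertex `s` by the
corresponding binary tree. -/
def graft : (P : PlaneTree) → ((s : InternalVertex P) → Y s.rank) → BTree
  | .leaf, _ => .nil
  | .node m child, t =>
      let b : Y (m + 1) := t (.root m child)
      graftLeaves b.1 fun i =>
        let j : Fin (m + 2) := Fin.cast (numLeaves_of_mem b) i
        graft (child j) fun s => t (.above m child j s)

/-- `IsGraft I P J`: the interval `I` equals `G(P, (J_s)_s)`, that is, its minimum (maximum) is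
the grafting along the plane tree `P` of the minima (maxima) of the intervals `J_s`. -/
def IsGraft {n : ℕ} (I : Interval n) (P : PlaneTree)
    (J : (s : InternalVertex P) → Interval s.rank) : Prop :=
  I.fst.1 = graft P (fun s => (J s).fst) ∧ I.snd.1 = graft P (fun s => (J s).snd)

/-- An interval is new if it is not of the form `G(P, (J_s)_s)` for a plane tree `P` with at
least two internal vertices. -/
def IsNew {n : ℕ} (I : Interval n) : Prop :=
  ¬ ∃ (P : PlaneTree) (J : (s : InternalVertex P) → Interval s.rank),
    Nontrivial (InternalVertex P) ∧ IsGraft I P J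

/-- The number of new intervals in the Tamari lattice `Y_n`. -/
noncomputable def numNew (n : ℕ) : ℕ := Nat.card {I : Interval n // IsNew I}

/-- The generating function `ν = ∑_{n ≥ 1} numNew n * y ^ (n + 1)`. -/
noncomputable def nu : PowerSeries ℚ :=
  PowerSeries.mk fun k => if 2 ≤ k then (numNew (k - 1) : ℚ) else 0

end Tamari

/-!
An interval `[S, T]` of the Tamari lattice fails to be new exactly when some proper nontrivial set
of consecutive leaves spans a subtree of both `S` and `T` (`isNew_iff`): grafting along a plane tree
creates such a common subtree, and conversely the two trees obtained by contracting a common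
subtree, as well as the two subtrees themselves, are again comparable (`TamariLE.of_graftAt`).
The latter rests on a recursive description of the order (`tamariLE_node_iff`): `S ≤ T₁ ∨ T₂` means
that the root of the larger tree sits on the right border of `S`, so that `S` comes from some
`S' ≤ T₁` and `S₂ ≤ T₂` by inserting `S₂` at a place of the right border of `S'`.

For a new interval, `T₂` must be trivial, since it would be a common subtree. So a new interval with
at least two internal vertices amounts to an interval `[S', T₁]` and a place on the right border of
`S'` such that all the common subtrees of `S'` and `T₁` have their root below this place and contain
the last leaf (`isNewPair_iff`). Either `[S', T₁]` is itself new (`IsNewPair.extend`), or removing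
the largest proper common subtree splits off a new interval `[A, B]`, the rest being essentially a
smaller new interval (`IsNewPair.graftLast`, `IsNewPair.exists_graftLast`,
`IsNewPair.graftLast_inj`). If `V(x)` is the generating function of new intervals, where `x` records
the length of the right border of the minimum, this reads (`catalytic_equation`)
`(x - 1) (V(x) - x y) (1 - V(x)) = y x² (V(x) - V(1))`.

This equation is quadratic in `V(x)`, with a discriminant `Δ` which is cubic in `u = x - 1` over
`ℚ⟦y⟧`. As `Δ` is the square of a power series `D` in `u` which vanishes at a point of the maximal
ideal of `ℚ⟦y⟧`, the Weierstrass preparation theorem shows that `Δ` has a double root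
(`discrim_eq_zero_of_sq_eq`). The vanishing of the discriminant of `Δ` is, up to a nonzero factor,
the quadratic equation of the theorem, since `ν = y V(1)`. It says that
`(32 ν + 1 - 12 y - 8 y²)² = (1 - 8 y)³`, whence a two-term recurrence for the coefficients
(`coeff_recurrence_of_quadratic`), which is that of the closed formula.
-/

namespace Tamari

open BinaryTree (nil node)
open scoped BinaryTree

/-! ### Grafting binary trees -/

/-- `graftAt t i R` grafts `R` on the leaf number `i` of `t`, the leaves being numbered from left
to right, starting from `0`. -/
def graftAt : BTree → ℕ → BTree → BTree
  | .nil, i, R => if i = 0 then R else .nil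
  | .node _ l r, i, R =>
      if i ≤ l.numNodes then .node () (graftAt l i R) r
      else .node () l (graftAt r (i - (l.numNodes + 1)) R)

/-- `graftLast t R` grafts `R` on the last leaf of `t`. -/
def graftLast : BTree → BTree → BTree
  | .nil, R => R
  | .node _ l r, R => .node () l (graftLast r R)

/-- The number of internal vertices on the right border of a tree. -/
def spine : BTree → ℕ
  | .nil => 0
  | .node _ _ r => spine r + 1

@[simp] theorem graftLast_nil (R : BTree) : graftLast nil R = R := rfl

@[simp] theorem graftLast_node (l r R : BTree) :
    graftLast (l △ r) R = l △ graftLast r R := rfl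

@[simp] theorem graftAt_nil_zero (R : BTree) : graftAt nil 0 R = R := rfl

theorem graftAt_node_of_le {l r R : BTree} {i : ℕ} (h : i ≤ l.numNodes) :
    graftAt (l △ r) i R = graftAt l i R △ r := by
  simp [graftAt, h]

theorem graftAt_node_of_lt {l r R : BTree} {i : ℕ} (h : l.numNodes < i) :
    graftAt (l △ r) i R = l △ graftAt r (i - (l.numNodes + 1)) R := by
  simp [graftAt, h]

theorem graftAt_node_add (l r R : BTree) (i : ℕ) :
    graftAt (l △ r) (l.numNodes + 1 + i) R = l △ graftAt r i R := by
  rw [graftAt_node_of_lt (by omega), Nat.add_sub_cancel_left]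

theorem numNodes_graftAt {t : BTree} (R : BTree) : ∀ {i : ℕ}, i ≤ t.numNodes →
    (graftAt t i R).numNodes = t.numNodes + R.numNodes := by
  induction t using BinaryTree.unitRecOn with
  | base =>
    intro i hi
    obtain rfl : i = 0 := by simpa using hi
    simp
  | ind l r ihl ihr =>
    intro i hi
    simp only [BinaryTree.numNodes] at hi
    rcases le_or_gt i l.numNodes with h | h
    · rw [graftAt_node_of_le h]
      simp only [BinaryTree.numNodes, ihl h]
      omega
    · rw [graftAt_node_of_lt h]
      simp only [BinaryTree.numNodes]
      rw [ihr (by omega)]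
      omega

@[simp] theorem numNodes_graftLast (t R : BTree) :
    (graftLast t R).numNodes = t.numNodes + R.numNodes := by
  induction t using BinaryTree.unitRecOn with
  | base => simp
  | ind l r ihl ihr => simp only [graftLast_node, BinaryTree.numNodes, ihr]; omega

@[simp] theorem spine_nil : spine nil = 0 := rfl

@[simp] theorem spine_node (l r : BTree) : spine (l △ r) = spine r + 1 := rfl

@[simp] theorem spine_graftLast (t R : BTree) : spine (graftLast t R) = spine t + spine R := by
  induction t using BinaryTree.unitRecOn with
  | base => simp
  | ind l r ihl ihr => simp only [graftLast_node, spine_node, ihr]; omega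

theorem eq_nil_of_numNodes_eq_zero {t : BTree} (h : t.numNodes = 0) : t = nil := by
  cases t using BinaryTree.unitRecOn with
  | base => rfl
  | ind => simp at h

theorem graftAt_numNodes (t R : BTree) : graftAt t t.numNodes R = graftLast t R := by
  induction t using BinaryTree.unitRecOn with
  | base => rfl
  | ind l r ihl ihr =>
    rw [graftLast_node, ← ihr]
    simp only [BinaryTree.numNodes]
    rw [← graftAt_node_add]
    congr 1
    omega

theorem graftLast_assoc (A B C : BTree) :
    graftLast (graftLast A B) C = graftLast A (graftLast B C) := by
  induction A using BinaryTree.unitRecOn with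
  | base => rfl
  | ind l r ihl ihr => simp [ihr]

theorem graftLast_graftAt (A C R : BTree) (i : ℕ) :
    graftLast A (graftAt C i R) = graftAt (graftLast A C) (A.numNodes + i) R := by
  induction A using BinaryTree.unitRecOn with
  | base => simp
  | ind l r ihl ihr =>
    rw [graftLast_node, graftLast_node, ihr, ← graftAt_node_add]
    simp only [BinaryTree.numNodes]
    congr 1
    omega

theorem graftLast_of_graftAt {A : BTree} (C R : BTree) : ∀ {i : ℕ}, i < A.numNodes →
    graftLast (graftAt A i R) C = graftAt (graftLast A C) i R := by
  induction A using BinaryTree.unitRecOn with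
  | base => intro i hi; simp at hi
  | ind l r ihl ihr =>
    intro i hi
    simp only [BinaryTree.numNodes] at hi
    rcases le_or_gt i l.numNodes with h | h
    · rw [graftAt_node_of_le h, graftLast_node, graftLast_node, graftAt_node_of_le h]
    · rw [graftAt_node_of_lt h, graftLast_node, graftLast_node, graftAt_node_of_lt h,
        ihr (by omega)]

theorem eq_graftLast_of_graftLast_eq {A C L : BTree} : ∀ {X : BTree},
    graftLast A C = graftLast X L → A.numNodes ≤ X.numNodes →
    ∃ X₂, X = graftLast A X₂ ∧ C = graftLast X₂ L := by
  induction A using BinaryTree.unitRecOn with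
  | base => intro X h _; exact ⟨X, rfl, h⟩
  | ind l r ihl ihr =>
    intro X h hX
    cases X using BinaryTree.unitRecOn with
    | base => simp at hX
    | ind x y _ _ =>
      simp only [graftLast_node, BinaryTree.node.injEq, true_and, BinaryTree.numNodes] at h hX
      obtain ⟨rfl, h⟩ := h
      obtain ⟨X₂, rfl, h₂⟩ := ihr h (by omega)
      exact ⟨X₂, rfl, h₂⟩

/-! ### Relative position of two subtrees -/

/-- A subtree located weakly to the right of the subtree grafted on the last leaf lies in it. -/
theorem graftAt_eq_graftLast_of_le {A C R : BTree} : ∀ {S : BTree} {i : ℕ},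
    graftAt S i R = graftLast A C → i ≤ S.numNodes → A.numNodes ≤ i →
    ∃ C₀, C = graftAt C₀ (i - A.numNodes) R ∧ S = graftLast A C₀ := by
  induction A using BinaryTree.unitRecOn with
  | base => intro S i h _ _; exact ⟨S, by simpa using h.symm, rfl⟩
  | ind a A ihl ihr =>
    intro S i h hi hA
    simp only [BinaryTree.numNodes] at hA
    cases S using BinaryTree.unitRecOn with
    | base => simp at hi; omega
    | ind s t _ _ =>
      simp only [BinaryTree.numNodes] at hi
      rcases le_or_gt i s.numNodes with h' | h'
      · rw [graftAt_node_of_le h'] at h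
        simp only [graftLast_node, BinaryTree.node.injEq, true_and] at h
        have := congrArg BinaryTree.numNodes h.1
        rw [numNodes_graftAt _ h'] at this
        omega
      · rw [graftAt_node_of_lt h'] at h
        simp only [graftLast_node, BinaryTree.node.injEq, true_and] at h
        obtain ⟨rfl, h⟩ := h
        obtain ⟨C₀, h₁, rfl⟩ := ihr h (by omega) (by omega)
        refine ⟨C₀, ?_, rfl⟩
        rw [h₁]
        congr 1
        simp only [BinaryTree.numNodes]
        omega

/-- A subtree `R` starting to the left of the subtree `C` grafted on the last leaf is either
disjoint from `C` or contains it. -/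
theorem graftAt_eq_graftLast_of_lt {A C R : BTree} : ∀ {S : BTree} {i : ℕ},
    graftAt S i R = graftLast A C → i ≤ S.numNodes → i < A.numNodes →
    (i + R.numNodes < A.numNodes ∧
      ∃ X, A = graftAt X i R ∧ i ≤ X.numNodes ∧ X.numNodes + R.numNodes = A.numNodes) ∨
    (i + R.numNodes = A.numNodes + C.numNodes ∧ i = S.numNodes ∧
      ∃ R₀, A = graftAt S i R₀ ∧ R₀.numNodes + C.numNodes = R.numNodes) := by
  induction A using BinaryTree.unitRecOn with
  | base => intro S i _ _ h; simp at h
  | ind a A ihl ihr =>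
    intro S i h hi hA
    simp only [BinaryTree.numNodes] at hA
    cases S using BinaryTree.unitRecOn with
    | base =>
      obtain rfl : i = 0 := by simpa using hi
      obtain rfl : R = graftLast (a △ A) C := h
      refine Or.inr ⟨by simp; omega, rfl, _, rfl, by simp; omega⟩
    | ind s t _ _ =>
      simp only [BinaryTree.numNodes] at hi
      rcases le_or_gt i s.numNodes with h' | h'
      · rw [graftAt_node_of_le h'] at h
        simp only [graftLast_node, BinaryTree.node.injEq, true_and] at h
        obtain ⟨rfl, rfl⟩ := h
        refine Or.inl ⟨?_, s △ A, (graftAt_node_of_le h').symm, ?_, ?_⟩ <;>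
          simp only [BinaryTree.numNodes, numNodes_graftAt _ h'] <;> omega
      · rw [graftAt_node_of_lt h'] at h
        simp only [graftLast_node, BinaryTree.node.injEq, true_and] at h
        obtain ⟨rfl, h⟩ := h
        rcases ihr h (by omega) (by omega) with ⟨h₁, X, rfl, h₂, h₃⟩ | ⟨h₁, h₂, R₀, rfl, h₃⟩
        · refine Or.inl ⟨?_, s △ X, (graftAt_node_of_lt h').symm, ?_, ?_⟩ <;>
            simp only [BinaryTree.numNodes] <;> omega
        · refine Or.inr ⟨?_, ?_, R₀, (graftAt_node_of_lt h').symm, h₃⟩ <;>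
            simp only [BinaryTree.numNodes] <;> omega

/-- A subtree `R` of `graftLast X (L ∨ S₂)` which ends before the leaves of `S₂` is also a subtree
of the tree `graftLast X L` obtained by removing `S₂`, at the same place; contracting `R` commutes
with this removal. -/
theorem graftAt_eq_graftLast_node_left {L S₂ R : BTree} {X : BTree} : ∀ {S : BTree} {i : ℕ},
    graftAt S i R = graftLast X (L △ S₂) → i ≤ S.numNodes →
    i + R.numNodes ≤ X.numNodes + L.numNodes →
    ∃ X₀ L₀, graftLast X L = graftAt (graftLast X₀ L₀) i R ∧ S = graftLast X₀ (L₀ △ S₂) ∧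
      i ≤ (graftLast X₀ L₀).numNodes ∧ (i < (graftLast X₀ L₀).numNodes ∨ X.numNodes ≤ i) := by
  induction X using BinaryTree.unitRecOn with
  | base =>
    intro S i h hi hL
    simp only [BinaryTree.numNodes, zero_add] at hL
    cases S using BinaryTree.unitRecOn with
    | base =>
      obtain rfl : i = 0 := by simpa using hi
      have := congrArg BinaryTree.numNodes h
      simp at this
      omega
    | ind s t _ _ =>
      rcases le_or_gt i s.numNodes with h' | h'
      · rw [graftAt_node_of_le h'] at h
        simp only [graftLast_nil, BinaryTree.node.injEq, true_and] at h
        obtain ⟨rfl, rfl⟩ := h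
        exact ⟨nil, s, rfl, rfl, h', Or.inr (Nat.zero_le _)⟩
      · rw [graftAt_node_of_lt h'] at h
        simp only [graftLast_nil, BinaryTree.node.injEq, true_and] at h
        obtain ⟨rfl, h⟩ := h
        omega
  | ind a X ihl ihr =>
    intro S i h hi hL
    simp only [BinaryTree.numNodes] at hL
    cases S using BinaryTree.unitRecOn with
    | base =>
      obtain rfl : i = 0 := by simpa using hi
      have := congrArg BinaryTree.numNodes h
      simp at this
      omega
    | ind s t _ _ =>
      simp only [BinaryTree.numNodes] at hi
      rcases le_or_gt i s.numNodes with h' | h'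
      · rw [graftAt_node_of_le h'] at h
        simp only [graftLast_node, BinaryTree.node.injEq, true_and] at h
        obtain ⟨rfl, rfl⟩ := h
        refine ⟨s △ X, L, (graftAt_node_of_le h').symm, rfl, ?_⟩
        simp only [graftLast_node, BinaryTree.numNodes]
        exact ⟨by omega, Or.inl (by omega)⟩
      · rw [graftAt_node_of_lt h'] at h
        simp only [graftLast_node, BinaryTree.node.injEq, true_and] at h
        obtain ⟨rfl, h⟩ := h
        obtain ⟨X₀, L₀, h₁, rfl, h₂, h₃⟩ := ihr h (by omega) (by omega)
        refine ⟨s △ X₀, L₀, ?_, rfl, ?_⟩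
        · rw [graftLast_node, h₁, graftLast_node, graftAt_node_of_lt h']
        · simp only [graftLast_node, BinaryTree.numNodes]
          omega

/-- The converse of `graftAt_eq_graftLast_node_left`, for subtrees which are not met by the part
`X` of the right border. -/
theorem graftLast_node_eq_graftAt {L R : BTree} (S₂ : BTree) {X : BTree} :
    ∀ {S : BTree} {i : ℕ}, graftLast X L = graftAt S i R → i ≤ S.numNodes →
    (i < S.numNodes ∨ X.numNodes ≤ i) →
    ∃ S', graftLast X (L △ S₂) = graftAt S' i R ∧ i ≤ S'.numNodes ∧
      S'.numNodes = S.numNodes + S₂.numNodes + 1 := by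
  induction X using BinaryTree.unitRecOn with
  | base =>
    intro S i h hi _
    refine ⟨S △ S₂, ?_, by simp only [BinaryTree.numNodes]; omega, rfl⟩
    rw [graftAt_node_of_le hi, ← h]
    rfl
  | ind a X ihl ihr =>
    intro S i h hi hL
    simp only [BinaryTree.numNodes] at hL
    cases S using BinaryTree.unitRecOn with
    | base =>
      simp at hi hL
      omega
    | ind s t _ _ =>
      simp only [BinaryTree.numNodes] at hi hL
      rcases le_or_gt i s.numNodes with h' | h'
      · rw [graftAt_node_of_le h'] at h
        simp only [graftLast_node, BinaryTree.node.injEq, true_and] at h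
        obtain ⟨rfl, h⟩ := h
        refine ⟨s △ graftLast X (L △ S₂), (graftAt_node_of_le h').symm, ?_, ?_⟩
        · simp only [BinaryTree.numNodes]; omega
        · simp only [BinaryTree.numNodes, ← h, numNodes_graftLast]; omega
      · rw [graftAt_node_of_lt h'] at h
        simp only [graftLast_node, BinaryTree.node.injEq, true_and] at h
        obtain ⟨rfl, h⟩ := h
        obtain ⟨S', h₁, h₂, h₃⟩ := ihr h (by omega) (by omega)
        refine ⟨a △ S', ?_, ?_, ?_⟩
        · rw [graftLast_node, h₁, graftAt_node_of_lt h']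
        · simp only [BinaryTree.numNodes]; omega
        · simp only [BinaryTree.numNodes]; omega

/-! ### The Tamari order -/

/-- The Tamari order on all binary trees; only trees of the same size are comparable. -/
abbrev TamariLE (S T : BTree) : Prop := Relation.ReflTransGen Rotates S T

theorem TamariLE.numNodes_eq {S T : BTree} (h : TamariLE S T) : S.numNodes = T.numNodes := by
  induction h with
  | refl => rfl
  | tail _ hr ih => exact ih.trans hr.numNodes_eq

theorem TamariLE.node {A A' B B' : BTree} (hA : TamariLE A A') (hB : TamariLE B B') :
    TamariLE (A △ B) (A' △ B') :=
  (Relation.ReflTransGen.lift (p := Rotates) (fun t => t △ B) (fun _ _ h => Rotates.left B h)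
    _ _ hA).trans
    (Relation.ReflTransGen.lift (p := Rotates) (fun t => A' △ t)
      (fun _ _ h => Rotates.right A' h) _ _ hB)

theorem Rotates.graftLast_left {A B : BTree} (h : Rotates A B) (C : BTree) :
    Rotates (graftLast A C) (graftLast B C) := by
  induction h with
  | rotate A B D => exact .rotate A B _
  | left B h ih => exact .left _ h
  | right A h ih => exact .right A ih

theorem TamariLE.graftLast {A B C D : BTree} (hA : TamariLE A B) (hC : TamariLE C D) :
    TamariLE (graftLast A C) (graftLast B D) := by
  refine (Relation.ReflTransGen.lift (p := Rotates) (fun t => Tamari.graftLast t C)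
    (fun _ _ h => Rotates.graftLast_left h C) _ _ hA).trans ?_
  clear hA
  induction B using BinaryTree.unitRecOn with
  | base => exact hC
  | ind l r ihl ihr => exact TamariLE.node .refl ihr

theorem tamariLE_graftLast_node (X L R : BTree) :
    TamariLE (graftLast X (L △ R)) (graftLast X L △ R) := by
  induction X using BinaryTree.unitRecOn with
  | base => exact .refl
  | ind a X ihl ihr => exact (TamariLE.node .refl ihr).tail (.rotate a _ R)

/-- Going down from a tree of the form `graftLast X (L ∨ R)` does not increase `graftLast X L`
and `R`. -/
theorem Rotates.exists_of_graftLast_node {L R X : BTree} : ∀ {S : BTree},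
    Rotates S (graftLast X (L △ R)) → ∃ X' L' R', S = graftLast X' (L' △ R') ∧
      TamariLE (graftLast X' L') (graftLast X L) ∧ TamariLE R' R := by
  induction X using BinaryTree.unitRecOn with
  | base =>
    intro S h
    cases h with
    | rotate A B C => exact ⟨A △ nil, B, R, rfl, .refl, .refl⟩
    | left B h => exact ⟨nil, _, R, rfl, .single h, .refl⟩
    | right A h => exact ⟨nil, L, _, rfl, .refl, .single h⟩
  | ind a X ihl ihr =>
    intro S h
    cases h with
    | rotate A B C => exact ⟨A △ (B △ X), L, R, rfl, .single (.rotate A B _), .refl⟩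
    | left B h => exact ⟨_ △ X, L, R, rfl, .single (.left _ h), .refl⟩
    | right A h =>
      obtain ⟨X', L', R', rfl, h₁, h₂⟩ := ihr h
      exact ⟨a △ X', L', R', rfl, .node .refl h₁, h₂⟩

/-- The recursive description of the Tamari order: the root of the larger tree lies on the right
border of the smaller one. -/
theorem tamariLE_node_iff {S T₁ T₂ : BTree} :
    TamariLE S (T₁ △ T₂) ↔ ∃ X L R, S = graftLast X (L △ R) ∧
      TamariLE (graftLast X L) T₁ ∧ TamariLE R T₂ := by
  constructor
  · intro h
    induction h using Relation.ReflTransGen.head_induction_on with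
    | refl => exact ⟨nil, T₁, T₂, rfl, .refl, .refl⟩
    | head h _ ih =>
      obtain ⟨X, L, R, rfl, h₁, h₂⟩ := ih
      obtain ⟨X', L', R', rfl, h₃, h₄⟩ := h.exists_of_graftLast_node
      exact ⟨X', L', R', rfl, h₃.trans h₁, h₄.trans h₂⟩
  · rintro ⟨X, L, R, rfl, h₁, h₂⟩
    exact (tamariLE_graftLast_node X L R).trans (TamariLE.node h₁ h₂)

/-- Two comparable trees with a subtree at the same place: both the subtrees and the trees obtained
by contracting them are comparable. -/
theorem TamariLE.of_graftAt {T : BTree} : ∀ {S R R' : BTree} {i : ℕ},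
    TamariLE (graftAt S i R) (graftAt T i R') → S.numNodes = T.numNodes →
    R.numNodes = R'.numNodes → i ≤ S.numNodes → TamariLE S T ∧ TamariLE R R' := by
  induction T using BinaryTree.unitRecOn with
  | base =>
    intro S R R' i h hS hR hi
    obtain rfl := eq_nil_of_numNodes_eq_zero hS
    obtain rfl : i = 0 := by simpa using hi
    exact ⟨.refl, h⟩
  | ind T₁ T₂ ih₁ ih₂ =>
    intro S R R' i h hS hR hi
    simp only [BinaryTree.numNodes] at hS
    rcases le_or_gt i T₁.numNodes with h' | h'
    · rw [graftAt_node_of_le h', tamariLE_node_iff] at h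
      obtain ⟨X, L, S₂, h₁, h₂, h₃⟩ := h
      have hs := h₂.numNodes_eq
      rw [numNodes_graftAt _ h', numNodes_graftLast] at hs
      obtain ⟨X₀, L₀, h₄, rfl, h₅, _⟩ := graftAt_eq_graftLast_node_left h₁ hi (by omega)
      rw [h₄] at h₂
      have hs₃ := h₃.numNodes_eq
      simp only [numNodes_graftLast, BinaryTree.numNodes] at hS
      obtain ⟨h₆, h₇⟩ := ih₁ h₂ (by rw [numNodes_graftLast]; omega) hR h₅
      exact ⟨tamariLE_node_iff.2 ⟨X₀, L₀, S₂, rfl, h₆, h₃⟩, h₇⟩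
    · rw [graftAt_node_of_lt h', tamariLE_node_iff] at h
      obtain ⟨X, L, S₂, h₁, h₂, h₃⟩ := h
      have hs := h₂.numNodes_eq
      rw [numNodes_graftLast] at hs
      have h₁' : graftAt S i R = Tamari.graftLast (Tamari.graftLast X (L △ nil)) S₂ := by
        rw [h₁, graftLast_assoc]; rfl
      obtain ⟨C₀, h₄, rfl⟩ := graftAt_eq_graftLast_of_le h₁' hi (by simp; omega)
      simp only [numNodes_graftLast, BinaryTree.numNodes, add_zero] at h₄ hS hi
      rw [show X.numNodes + (L.numNodes + 1) = T₁.numNodes + 1 by omega] at h₄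
      rw [h₄] at h₃
      obtain ⟨h₆, h₇⟩ := ih₂ h₃ (by omega) hR (by omega)
      refine ⟨tamariLE_node_iff.2 ⟨X, L, C₀, ?_, h₂, h₆⟩, h₇⟩
      rw [graftLast_assoc]; rfl

/-! ### Common subtrees and grafting of sequences -/

/-- A pair of trees is decomposable when a proper nontrivial set of consecutive leaves spans a
subtree of both trees, at the same place. -/
def Decomposable (S T : BTree) : Prop :=
  ∃ (S₀ T₀ R R' : BTree) (i : ℕ), S₀.numNodes = T₀.numNodes ∧ 1 ≤ S₀.numNodes ∧
    R.numNodes = R'.numNodes ∧ 1 ≤ R.numNodes ∧ i ≤ S₀.numNodes ∧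
    S = graftAt S₀ i R ∧ T = graftAt T₀ i R'

/-- Graft the trees `f 0, f 1, …` on the leaves of a binary tree; a version of `graftLeaves`
where the trees to be grafted are indexed by all natural numbers. -/
def graftSeq : BTree → (ℕ → BTree) → BTree
  | .nil, f => f 0
  | .node _ l r, f => .node () (graftSeq l f) (graftSeq r fun i => f (l.numNodes + 1 + i))

@[simp] theorem graftSeq_nil (f : ℕ → BTree) : graftSeq nil f = f 0 := rfl

@[simp] theorem graftSeq_node (l r : BTree) (f : ℕ → BTree) :
    graftSeq (l △ r) f = graftSeq l f △ graftSeq r fun i => f (l.numNodes + 1 + i) := rfl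

theorem graftLeaves_eq_graftSeq {t : BTree} : ∀ {f : Fin t.numLeaves → BTree} {g : ℕ → BTree},
    (∀ i, f i = g i) → graftLeaves t f = graftSeq t g := by
  induction t using BinaryTree.unitRecOn with
  | base => intro f g h; exact h (0 : Fin 1)
  | ind l r ihl ihr =>
    intro f g h
    rw [graftLeaves, graftSeq_node, ihl (g := g), ihr (g := fun i => g (l.numNodes + 1 + i))]
    · intro i
      refine (h _).trans ?_
      simp [BinaryTree.numLeaves_eq_numNodes_succ]
    · intro i
      exact h _

theorem graftSeq_congr {t : BTree} : ∀ {f g : ℕ → BTree}, (∀ i ≤ t.numNodes, f i = g i) →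
    graftSeq t f = graftSeq t g := by
  induction t using BinaryTree.unitRecOn with
  | base => intro f g h; exact h 0 le_rfl
  | ind l r ihl ihr =>
    intro f g h
    simp only [BinaryTree.numNodes] at h
    rw [graftSeq_node, graftSeq_node, ihl fun i hi => h i (by omega),
      ihr fun i hi => h _ (by omega)]

theorem graftSeq_const_nil (t : BTree) : graftSeq t (fun _ => nil) = t := by
  induction t using BinaryTree.unitRecOn with
  | base => rfl
  | ind l r ihl ihr => rw [graftSeq_node, ihl, ihr]

theorem numNodes_graftSeq {t : BTree} : ∀ f : ℕ → BTree, (graftSeq t f).numNodes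
    = t.numNodes + ∑ j ∈ Finset.range (t.numNodes + 1), (f j).numNodes := by
  induction t using BinaryTree.unitRecOn with
  | base => intro f; simp
  | ind l r ihl ihr =>
    intro f
    simp only [graftSeq_node, BinaryTree.numNodes]
    rw [ihl, ihr, show l.numNodes + r.numNodes + 1 + 1 = (l.numNodes + 1) + (r.numNodes + 1) by
      omega, Finset.sum_range_add _ (l.numNodes + 1) (r.numNodes + 1)]
    omega

/-- Grafting a sequence of trees can be done by grafting one of them last. -/
theorem graftSeq_eq_graftAt {t : BTree} : ∀ {f : ℕ → BTree} {i : ℕ}, i ≤ t.numNodes →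
    graftSeq t f = graftAt (graftSeq t (Function.update f i nil))
      (∑ j ∈ Finset.range i, ((f j).numNodes + 1)) (f i) ∧
    ∑ j ∈ Finset.range i, ((f j).numNodes + 1) ≤
      (graftSeq t (Function.update f i nil)).numNodes := by
  induction t using BinaryTree.unitRecOn with
  | base =>
    intro f i hi
    obtain rfl : i = 0 := by simpa using hi
    simp
  | ind l r ihl ihr =>
    intro f i hi
    simp only [BinaryTree.numNodes] at hi
    rcases le_or_gt i l.numNodes with h | h
    · obtain ⟨h₁, h₂⟩ := ihl (f := f) h
      have hr : graftSeq r (fun j => Function.update f i nil (l.numNodes + 1 + j))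
          = graftSeq r fun j => f (l.numNodes + 1 + j) :=
        graftSeq_congr fun j _ => Function.update_of_ne (by omega) _ _
      rw [graftSeq_node, graftSeq_node, graftAt_node_of_le h₂, ← h₁, hr]
      refine ⟨rfl, ?_⟩
      simp only [BinaryTree.numNodes]
      omega
    · obtain ⟨k, rfl⟩ := Nat.exists_eq_add_of_le (show l.numNodes + 1 ≤ i from h)
      obtain ⟨h₁, h₂⟩ := ihr (f := fun j => f (l.numNodes + 1 + j)) (i := k) (by omega)
      have hl : graftSeq l (Function.update f (l.numNodes + 1 + k) nil) = graftSeq l f :=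
        graftSeq_congr fun j _ => Function.update_of_ne (by omega) _ _
      have hr : (fun j => Function.update f (l.numNodes + 1 + k) nil (l.numNodes + 1 + j))
          = Function.update (fun j => f (l.numNodes + 1 + j)) k nil := by
        ext1 j
        simp [Function.update_apply]
      have hs : ∑ j ∈ Finset.range (l.numNodes + 1 + k), ((f j).numNodes + 1)
          = (graftSeq l f).numNodes + 1
            + ∑ j ∈ Finset.range k, ((f (l.numNodes + 1 + j)).numNodes + 1) := by
        rw [Finset.sum_range_add, numNodes_graftSeq, Finset.sum_add_distrib (f := fun j =>
          (f j).numNodes)]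
        simp
        omega
      rw [graftSeq_node, graftSeq_node, hl, hr, hs, graftAt_node_add, ← h₁]
      refine ⟨rfl, ?_⟩
      simp only [BinaryTree.numNodes]
      omega

theorem graftSeq_single {t : BTree} (R : BTree) {i : ℕ} (hi : i ≤ t.numNodes) :
    graftSeq t (fun j => if j = i then R else nil) = graftAt t i R := by
  rw [(graftSeq_eq_graftAt hi).1]
  have h₁ : Function.update (fun j => if j = i then R else nil) i nil = fun _ => nil := by
    ext1 j
    rw [Function.update_apply]
    split_ifs <;> rfl
  have h₂ : ∑ j ∈ Finset.range i, (BinaryTree.numNodes (if j = i then R else nil) + 1) = i := by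
    rw [Finset.sum_congr rfl (g := fun _ => 1)]
    · simp
    · intro j hj
      rw [if_neg (Finset.mem_range.1 hj).ne]
      rfl
  rw [h₁, h₂, graftSeq_const_nil, if_pos rfl]

/-! ### Grafting along a plane tree -/

theorem graft_node {m : ℕ} {child : Fin (m + 2) → PlaneTree}
    (t : (s : InternalVertex (.node m child)) → Y s.rank) :
    graft (.node m child) t = graftSeq (t (.root m child)).1 fun i =>
      if h : i < m + 2 then graft (child ⟨i, h⟩) fun s => t (.above m child ⟨i, h⟩ s)
      else nil := by
  rw [graft]
  refine graftLeaves_eq_graftSeq fun i => ?_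
  have h : (i : ℕ) < m + 2 := i.2.trans_eq (numLeaves_of_mem (m := m) (t (.root m child)))
  rw [dif_pos h]
  rfl

/-- The size of a grafting along `P` depends on `P` only. -/
theorem numNodes_graft_congr {P : PlaneTree} (t t' : (s : InternalVertex P) → Y s.rank) :
    (graft P t).numNodes = (graft P t').numNodes := by
  induction P with
  | leaf => rfl
  | node m child ih =>
    have h := (t (.root m child)).2
    have h' := (t' (.root m child)).2
    rw [graft_node, graft_node, numNodes_graftSeq, numNodes_graftSeq, h, h']
    congr 1
    refine Finset.sum_congr rfl fun j _ => ?_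
    split_ifs
    · exact ih _ _ _
    · rfl

theorem numNodes_graft_pos {P : PlaneTree} (s : InternalVertex P)
    (t : (s : InternalVertex P) → Y s.rank) : 1 ≤ (graft P t).numNodes := by
  cases P with
  | leaf => cases s
  | node m child =>
    have h : (t (.root m child)).1.numNodes = m + 1 := (t (.root m child)).2
    rw [graft_node, numNodes_graftSeq, h]
    omega

/-- A plane tree whose internal vertices are decorated with intervals. -/
abbrev DecoratedTree : Type := Σ P : PlaneTree, ((s : InternalVertex P) → Interval s.rank)

/-- The trivial decorated plane tree. -/
def DecoratedTree.leaf : DecoratedTree := ⟨.leaf, nofun⟩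

/-- The decorations of a plane tree built from a decorated bottom vertex and from decorated
subtrees. -/
def decorate {m : ℕ} (b : Interval (m + 1)) (g : Fin (m + 2) → DecoratedTree) :
    (s : InternalVertex (.node m fun j => (g j).1)) → Interval s.rank
  | .root _ _ => b
  | .above _ _ j s => (g j).2 s

/-- The decorated plane tree with bottom vertex decorated by `b` and with subtrees `g`. -/
def DecoratedTree.node {m : ℕ} (b : Interval (m + 1)) (g : Fin (m + 2) → DecoratedTree) :
    DecoratedTree := ⟨.node m fun j => (g j).1, decorate b g⟩

theorem graft_decoratedTree_node {m : ℕ} (b : Interval (m + 1)) (g : Fin (m + 2) → DecoratedTree)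
    (p : ∀ {n : ℕ}, Interval n → Y n) :
    graft (DecoratedTree.node b g).1 (fun s => p ((DecoratedTree.node b g).2 s)) =
      graftSeq (p b).1 fun i => if h : i < m + 2 then
        graft (g ⟨i, h⟩).1 fun s => p ((g ⟨i, h⟩).2 s) else nil :=
  graft_node _

/-- Grafting along a plane tree with two internal vertices. -/
theorem graft_two_vertices {m k : ℕ} (b : Interval (m + 1)) (c : Interval (k + 1))
    (p : ∀ {n : ℕ}, Interval n → Y n) (i : Fin (m + 2)) :
    let Q := DecoratedTree.node b fun j =>
      if j = i then DecoratedTree.node c fun _ => .leaf else .leaf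
    graft Q.1 (fun s => p (Q.2 s)) = graftAt (p b).1 i (p c).1 := by
  intro Q
  have hb : (p b).1.numNodes = m + 1 := (p b).2
  have hi := i.2
  rw [graft_decoratedTree_node, ← graftSeq_single _ (show (i : ℕ) ≤ (p b).1.numNodes by omega)]
  refine graftSeq_congr fun j hj => ?_
  rw [dif_pos (show j < m + 2 by omega)]
  have key {X Z : DecoratedTree} (h : X = Z) :
      graft X.1 (fun s => p (X.2 s)) = graft Z.1 fun s => p (Z.2 s) := by rw [h]
  by_cases h : j = i
  · rw [if_pos h, key (if_pos (Fin.ext h)), graft_decoratedTree_node]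
    refine (graftSeq_congr fun l _ => ?_).trans (graftSeq_const_nil _)
    split_ifs <;> rfl
  · rw [if_neg h, key (if_neg fun h' => h (congrArg Fin.val h'))]
    rfl

/-- The new intervals are those whose minimum and maximum have no proper nontrivial subtree at the
same place. -/
theorem isNew_iff {n : ℕ} (I : Interval n) : IsNew I ↔ ¬ Decomposable I.fst.1 I.snd.1 := by
  refine not_congr ⟨?_, ?_⟩
  · rintro ⟨P, J, hP, h₁, h₂⟩
    cases P with
    | leaf => obtain ⟨s, _⟩ := hP.exists_pair_ne; cases s
    | node m child =>
      obtain ⟨s, hs⟩ := exists_ne (InternalVertex.root m child)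
      cases s with
      | root => exact absurd rfl hs
      | above m child i s =>
        have hb : (J (.root m child)).fst.1.numNodes = m + 1 := (J (.root m child)).fst.2
        have hb' : (J (.root m child)).snd.1.numNodes = m + 1 := (J (.root m child)).snd.2
        rw [graft_node] at h₁ h₂
        set f : ℕ → BTree := fun i => if h : i < m + 2 then
          graft (child ⟨i, h⟩) fun s => (J (.above m child ⟨i, h⟩ s)).fst else nil with hf
        set f' : ℕ → BTree := fun i => if h : i < m + 2 then
          graft (child ⟨i, h⟩) fun s => (J (.above m child ⟨i, h⟩ s)).snd else nil with hf'
        have hi := i.2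
        have hff (j : ℕ) : (f j).numNodes = (f' j).numNodes := by
          simp only [hf, hf']
          split_ifs
          · exact numNodes_graft_congr _ _
          · rfl
        obtain ⟨e₁, e₂⟩ := graftSeq_eq_graftAt (f := f)
          (show (i : ℕ) ≤ (J (.root m child)).fst.1.numNodes by omega)
        obtain ⟨e₁', _⟩ := graftSeq_eq_graftAt (f := f')
          (show (i : ℕ) ≤ (J (.root m child)).snd.1.numNodes by omega)
        refine ⟨_, graftSeq (J (.root m child)).snd.1 (Function.update f' i nil), f i, f' i, _,
          ?_, ?_, hff i, ?_, e₂, h₁.trans e₁, ?_⟩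
        · rw [numNodes_graftSeq, numNodes_graftSeq, hb, hb']
          congr 1
          refine Finset.sum_congr rfl fun j _ => ?_
          rw [Function.update_apply, Function.update_apply]
          split_ifs
          · rfl
          · exact hff j
        · rw [numNodes_graftSeq, hb]
          omega
        · simp only [hf]
          rw [dif_pos hi]
          exact numNodes_graft_pos s _
        · rw [h₂, e₁']
          simp only [hff]
  · rintro ⟨S₀, T₀, R, R', i, hS, hS₀, hR, hR₀, hi, h₁, h₂⟩
    have hle : TamariLE I.fst.1 I.snd.1 := I.fst_le_snd
    rw [h₁, h₂] at hle
    obtain ⟨hST, hRR⟩ := hle.of_graftAt hS hR hi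
    obtain ⟨m, hm⟩ : ∃ m, S₀.numNodes = m + 1 := ⟨S₀.numNodes - 1, by omega⟩
    obtain ⟨k, hk⟩ : ∃ k, R.numNodes = k + 1 := ⟨R.numNodes - 1, by omega⟩
    let b : Interval (m + 1) := ⟨⟨⟨S₀, hm⟩, ⟨T₀, hS.symm.trans hm⟩⟩, hST⟩
    let c : Interval (k + 1) := ⟨⟨⟨R, hk⟩, ⟨R', hR.symm.trans hk⟩⟩, hRR⟩
    let i' : Fin (m + 2) := ⟨i, by omega⟩
    let g : Fin (m + 2) → DecoratedTree := fun j =>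
      if j = i' then DecoratedTree.node c fun _ => .leaf else .leaf
    refine ⟨(DecoratedTree.node b g).1, (DecoratedTree.node b g).2, ?_, ?_, ?_⟩
    · have : Nonempty (InternalVertex (g i').1) := by
        simp only [g, if_true]
        exact ⟨.root _ _⟩
      obtain ⟨s⟩ := this
      exact ⟨.root _ _, .above _ _ i' s, nofun⟩
    · rw [h₁]
      exact (graft_two_vertices b c (fun I => I.fst) i').symm
    · rw [h₂]
      exact (graft_two_vertices b c (fun I => I.snd) i').symm

/-! ### Recursive structure of new intervals -/

/-- New intervals, as pairs of trees with at least one internal vertex. -/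
def IsNewPair (S T : BTree) : Prop := TamariLE S T ∧ 1 ≤ T.numNodes ∧ ¬ Decomposable S T

/-- Every common subtree of `S` and `T`, including the trees themselves, contains the last leaf of
`S` and its root lies on `X`, where `X` is thought of as the lower part of the right border of
`S`. When `S` is `graftLast S₀ R`, the root of `R` lies on `X` as soon as `S₀` is smaller than `X`,
so that comparing sizes is enough. -/
def CommonSubtreesOn (X S T : BTree) : Prop :=
  ∀ (S₀ T₀ R R' : BTree) (i : ℕ), S₀.numNodes = T₀.numNodes → R.numNodes = R'.numNodes →
    1 ≤ R.numNodes → i ≤ S₀.numNodes → S = graftAt S₀ i R → T = graftAt T₀ i R' →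
    i = S₀.numNodes ∧ S₀.numNodes < X.numNodes

theorem graftLast_node_nil_inj {X L X' L' : BTree}
    (h : graftLast X (L △ nil) = graftLast X' (L' △ nil)) : X = X' ∧ L = L' := by
  induction X using BinaryTree.unitRecOn generalizing X' with
  | base =>
    cases X' using BinaryTree.unitRecOn with
    | base => simpa using h
    | ind a x _ _ =>
      simp only [graftLast_nil, graftLast_node, BinaryTree.node.injEq, true_and] at h
      have := congrArg BinaryTree.numNodes h.2
      simp at this
  | ind b y _ ih =>
    cases X' using BinaryTree.unitRecOn with
    | base =>
      simp only [graftLast_nil, graftLast_node, BinaryTree.node.injEq, true_and] at h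
      have := congrArg BinaryTree.numNodes h.2
      simp at this
    | ind a x _ _ =>
      simp only [graftLast_node, BinaryTree.node.injEq, true_and] at h
      obtain ⟨rfl, h⟩ := h
      obtain ⟨rfl, rfl⟩ := ih h
      exact ⟨rfl, rfl⟩

/-- The maximum of a new interval has a trivial right subtree, and removing the last leaf of both
trees leaves an interval whose common subtrees are nested along the right border. -/
theorem isNewPair_iff {S T : BTree} : IsNewPair S T ↔ ∃ X L T₁, S = graftLast X (L △ nil) ∧
    T = T₁ △ nil ∧ TamariLE (graftLast X L) T₁ ∧ CommonSubtreesOn X (graftLast X L) T₁ := by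
  constructor
  · rintro ⟨hle, hpos, hdec⟩
    cases T using BinaryTree.unitRecOn with
    | base => simp at hpos
    | ind T₁ T₂ _ _ =>
      obtain ⟨X, L, S₂, rfl, h₁, h₂⟩ := tamariLE_node_iff.1 hle
      have hs₁ := h₁.numNodes_eq
      have hs₂ := h₂.numNodes_eq
      rw [numNodes_graftLast] at hs₁
      -- The right subtree of the maximum would be common to both trees.
      have hT₂ : T₂.numNodes = 0 := by
        by_contra hne
        refine hdec ⟨graftLast X (L △ nil), T₁ △ nil, S₂, T₂, T₁.numNodes + 1, ?_, ?_, hs₂,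
          by omega, ?_, ?_, ?_⟩
        · simp only [numNodes_graftLast, BinaryTree.numNodes]; omega
        · simp only [numNodes_graftLast, BinaryTree.numNodes]; omega
        · simp only [numNodes_graftLast, BinaryTree.numNodes]; omega
        · have : T₁.numNodes + 1 = (graftLast X (L △ nil)).numNodes := by
            simp only [numNodes_graftLast, BinaryTree.numNodes]; omega
          rw [this, graftAt_numNodes, graftLast_assoc]
          rfl
        · exact (graftAt_node_add T₁ nil T₂ 0).symm
      obtain rfl := eq_nil_of_numNodes_eq_zero hT₂
      obtain rfl := eq_nil_of_numNodes_eq_zero (hs₂.trans hT₂)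
      refine ⟨X, L, T₁, rfl, rfl, h₁, fun S₀ T₀ R R' i hS hR hR₁ hi e₁ e₂ => ?_⟩
      by_contra hcon
      obtain ⟨S', h₃, h₄, h₅⟩ := graftLast_node_eq_graftAt nil e₁ hi (by omega)
      refine hdec ⟨S', T₀ △ nil, R, R', i, ?_, by omega, hR, hR₁, h₄, h₃, ?_⟩
      · rw [h₅]
        simp only [BinaryTree.numNodes]
        omega
      · rw [graftAt_node_of_le (by omega), e₂]
  · rintro ⟨X, L, T₁, rfl, rfl, hle, hcom⟩
    refine ⟨tamariLE_node_iff.2 ⟨X, L, nil, rfl, hle, .refl⟩,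
      by simp only [BinaryTree.numNodes]; omega, ?_⟩
    rintro ⟨S₀, T₀, R, R', i, hS, hS₁, hR, hR₁, hi, e₁, e₂⟩
    have hs := hle.numNodes_eq
    rw [numNodes_graftLast] at hs
    cases T₀ using BinaryTree.unitRecOn with
    | base => simp at hS; omega
    | ind b c _ _ =>
      simp only [BinaryTree.numNodes] at hS
      rcases le_or_gt i b.numNodes with h' | h'
      · rw [graftAt_node_of_le h'] at e₂
        simp only [BinaryTree.node.injEq, true_and] at e₂
        obtain ⟨rfl, rfl⟩ := e₂
        rw [numNodes_graftAt _ h'] at hs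
        obtain ⟨X₀, L₀, h₁, rfl, h₂, h₃⟩ := graftAt_eq_graftLast_node_left e₁.symm hi (by omega)
        simp only [numNodes_graftLast, BinaryTree.numNodes] at hS
        have := hcom _ _ R R' i (by rw [numNodes_graftLast]; omega) hR hR₁ h₂ h₁ rfl
        omega
      · rw [graftAt_node_of_lt h'] at e₂
        simp only [BinaryTree.node.injEq, true_and] at e₂
        have := congrArg BinaryTree.numNodes e₂.2
        rw [numNodes_graftAt _ (by omega)] at this
        simp only [BinaryTree.numNodes] at this
        omega

theorem IsNewPair.numNodes_eq {S T : BTree} (h : IsNewPair S T) : S.numNodes = T.numNodes :=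
  h.1.numNodes_eq

theorem not_isNewPair_graftLast {A B C D : BTree} (hAB : A.numNodes = B.numNodes)
    (hA : 1 ≤ A.numNodes) (hCD : C.numNodes = D.numNodes) (hC : 1 ≤ C.numNodes) :
    ¬ IsNewPair (graftLast A C) (graftLast B D) := fun h =>
  h.2.2 ⟨A, B, C, D, A.numNodes, hAB, hA, hCD, hC, le_rfl, (graftAt_numNodes A C).symm,
    by rw [hAB, graftAt_numNodes]⟩

/-- A new interval, with an additional leaf inserted on the right border of its minimum, above
the root. -/
theorem IsNewPair.extend {X L T : BTree} (h : IsNewPair (graftLast X L) T)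
    (hX : 1 ≤ X.numNodes) : IsNewPair (graftLast X (L △ nil)) (T △ nil) := by
  refine isNewPair_iff.2 ⟨X, L, T, rfl, rfl, h.1, fun S₀ T₀ R R' i hS hR hR₁ hi e₁ e₂ => ?_⟩
  rcases Nat.eq_zero_or_pos S₀.numNodes with h₀ | h₀
  · omega
  · exact absurd ⟨S₀, T₀, R, R', i, hS, h₀, hR, hR₁, hi, e₁, e₂⟩ h.2.2

theorem IsNewPair.one_le_of_extend {X L T : BTree}
    (h : IsNewPair (graftLast X (L △ nil)) (T △ nil)) (hT : 1 ≤ T.numNodes) :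
    1 ≤ X.numNodes := by
  obtain ⟨X', L', T', e₁, e₂, h₁, h₂⟩ := isNewPair_iff.1 h
  obtain ⟨rfl, rfl⟩ := graftLast_node_nil_inj e₁
  obtain ⟨rfl, -⟩ : T = T' ∧ True := by simpa using e₂
  have hs := h₁.numNodes_eq
  exact (h₂ nil nil _ _ 0 rfl hs (by omega) le_rfl rfl rfl).2

/-- Two new intervals, the second one with at least two internal vertices, give a third one by
grafting on the last leaf, up to the last leaf of the maximum. -/
theorem IsNewPair.graftLast {A B C D : BTree} (hAB : IsNewPair A B) (hCD : IsNewPair C (D △ nil))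
    (hD : 1 ≤ D.numNodes) : IsNewPair (graftLast A C) (graftLast B D △ nil) := by
  obtain ⟨X, L, D', rfl, e, hle, hcom⟩ := isNewPair_iff.1 hCD
  obtain ⟨rfl, -⟩ : D = D' ∧ True := by simpa using e
  have hA := hAB.numNodes_eq
  have hB := hAB.2.1
  have hs := hle.numNodes_eq
  refine isNewPair_iff.2 ⟨Tamari.graftLast A X, L, _, (graftLast_assoc _ _ _).symm, rfl, ?_, ?_⟩
  · rw [graftLast_assoc]
    exact hAB.1.graftLast hle
  · rw [graftLast_assoc]
    intro S₀ T₀ R R' i hS hR hR₁ hi e₁ e₂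
    have hsz := congrArg BinaryTree.numNodes e₁
    rw [numNodes_graftAt _ hi, numNodes_graftLast A] at hsz
    rw [numNodes_graftLast A X]
    rcases le_or_gt A.numNodes i with h | h
    · obtain ⟨C₀, h₁, rfl⟩ := graftAt_eq_graftLast_of_le e₁.symm hi h
      obtain ⟨D₀, h₂, rfl⟩ := graftAt_eq_graftLast_of_le e₂.symm (by omega) (by omega)
      rw [← hA] at h₂
      simp only [numNodes_graftLast] at hS hi ⊢
      have := hcom C₀ D₀ R R' _ (by omega) hR hR₁ (by omega) h₁ h₂
      omega
    · rcases graftAt_eq_graftLast_of_lt e₁.symm hi h with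
          ⟨h₁, Z, h₂, h₃, h₄⟩ | ⟨h₁, h₂, R₀, h₃, h₄⟩ <;>
        rcases graftAt_eq_graftLast_of_lt e₂.symm (by omega) (by omega) with
          ⟨h₁', Z', h₂', h₃', h₄'⟩ | ⟨h₁', h₂', R₀', h₃', h₄'⟩
      · exact absurd ⟨Z, Z', R, R', i, by omega, by omega, hR, hR₁, h₃, h₂, h₂'⟩ hAB.2.2
      · omega
      · omega
      · rcases Nat.eq_zero_or_pos S₀.numNodes with h₀ | h₀
        · omega
        · exact absurd ⟨S₀, T₀, R₀, R₀', i, hS, h₀, by omega, by omega, hi, h₃, h₃'⟩ hAB.2.2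

/-- Every new interval with at least two internal vertices which is not obtained by
`IsNewPair.extend` is obtained by `IsNewPair.graftLast`. -/
theorem IsNewPair.exists_graftLast {X L T : BTree}
    (h : IsNewPair (Tamari.graftLast X (L △ nil)) (T △ nil)) (hT : 1 ≤ T.numNodes)
    (hn : ¬ IsNewPair (Tamari.graftLast X L) T) :
    ∃ A B C D, IsNewPair A B ∧ IsNewPair C (D △ nil) ∧ 1 ≤ D.numNodes ∧
      Tamari.graftLast X (L △ nil) = Tamari.graftLast A C ∧ T = Tamari.graftLast B D := by
  classical
  obtain ⟨X', L', T', e₁, e₂, hle, hcom⟩ := isNewPair_iff.1 h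
  obtain ⟨rfl, rfl⟩ := graftLast_node_nil_inj e₁
  obtain ⟨rfl, -⟩ : T = T' ∧ True := by simpa using e₂
  have hdec : Decomposable (Tamari.graftLast X L) T := by
    by_contra hd
    exact hn ⟨hle, hT, hd⟩
  -- Among all decompositions, take the one with the largest proper common subtree.
  have hex : ∃ k, ∃ (S₀ T₀ R R' : BTree), S₀.numNodes = k ∧ S₀.numNodes = T₀.numNodes ∧
      1 ≤ S₀.numNodes ∧ R.numNodes = R'.numNodes ∧ 1 ≤ R.numNodes ∧
      Tamari.graftLast X L = Tamari.graftLast S₀ R ∧ T = Tamari.graftLast T₀ R' := by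
    obtain ⟨S₀, T₀, R, R', i, hS, hS₁, hR, hR₁, hi, e₃, e₄⟩ := hdec
    obtain ⟨rfl, _⟩ := hcom S₀ T₀ R R' i hS hR hR₁ hi e₃ e₄
    rw [graftAt_numNodes] at e₃
    rw [hS, graftAt_numNodes] at e₄
    exact ⟨_, S₀, T₀, R, R', rfl, hS, hS₁, hR, hR₁, e₃, e₄⟩
  obtain ⟨S₀, T₀, R, R', hk, hS, hS₁, hR, hR₁, e₃, e₄⟩ := Nat.find_spec hex
  have hmin := fun m => Nat.find_min (H := hex) (m := m)
  rw [← hk] at hmin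
  have hSX := (hcom S₀ T₀ R R' S₀.numNodes hS hR hR₁ le_rfl (by rw [e₃, graftAt_numNodes])
    (by rw [e₄, hS, graftAt_numNodes])).2
  obtain ⟨X₂, rfl, rfl⟩ := eq_graftLast_of_graftLast_eq e₃.symm hSX.le
  have hle' : TamariLE S₀ T₀ ∧ TamariLE (Tamari.graftLast X₂ L) R' := by
    refine TamariLE.of_graftAt (i := S₀.numNodes) ?_ hS hR le_rfl
    rw [graftAt_numNodes, hS, graftAt_numNodes, ← e₄, ← e₃]
    exact hle
  refine ⟨S₀, T₀, Tamari.graftLast X₂ (L △ nil), R', ⟨hle'.1, by omega, ?_⟩, ?_, by omega,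
    graftLast_assoc _ _ _, e₄⟩
  · rintro ⟨S₁, T₁, R₁, R₁', i, g₁, g₂, g₃, g₄, g₅, rfl, rfl⟩
    rcases g₅.lt_or_eq with hi | rfl
    · rw [graftLast_of_graftAt _ _ (by omega)] at e₄
      have := hcom _ _ R₁ R₁' i (by simp only [numNodes_graftLast] at hR ⊢; omega) g₃ g₄
        (by rw [numNodes_graftLast]; omega)
        (e₃.trans (graftLast_of_graftAt _ _ hi)) e₄
      rw [numNodes_graftLast] at this
      omega
    · rw [g₁, graftAt_numNodes, graftLast_assoc] at e₄
      refine hmin S₁.numNodes (by rw [graftAt_numNodes, numNodes_graftLast]; omega)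
        ⟨S₁, T₁, _, _, rfl, g₁, g₂, ?_, ?_,
          e₃.trans (by rw [graftAt_numNodes, graftLast_assoc]), e₄⟩
      · rw [numNodes_graftLast, numNodes_graftLast R₁', g₃, hR]
      · rw [numNodes_graftLast]; omega
  · refine isNewPair_iff.2 ⟨X₂, L, R', rfl, rfl, hle'.2, ?_⟩
    intro C₀ D₀ R₂ R₂' i g₁ g₂ g₃ g₄ e₅ e₆
    have := hcom (Tamari.graftLast S₀ C₀) (Tamari.graftLast T₀ D₀) R₂ R₂' (S₀.numNodes + i)
      (by simp only [numNodes_graftLast]; omega) g₂ g₃ (by simp only [numNodes_graftLast]; omega)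
      (by rw [← graftLast_graftAt, ← e₅, graftLast_assoc])
      (by rw [hS, ← graftLast_graftAt, ← e₆, e₄])
    simp only [numNodes_graftLast] at this
    omega

theorem IsNewPair.graftLast_inj {A B A₂ B₂ C C₂ D D₂ : BTree} (h : IsNewPair A B)
    (h₂ : IsNewPair A₂ B₂) (hC : Tamari.graftLast A C = Tamari.graftLast A₂ C₂)
    (hD : Tamari.graftLast B D = Tamari.graftLast B₂ D₂) :
    A = A₂ ∧ B = B₂ ∧ C = C₂ ∧ D = D₂ := by
  wlog hle : A.numNodes ≤ A₂.numNodes generalizing A B A₂ B₂ C C₂ D D₂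
  · obtain ⟨rfl, rfl, rfl, rfl⟩ := this h₂ h hC.symm hD.symm (by omega)
    exact ⟨rfl, rfl, rfl, rfl⟩
  have hs := h.numNodes_eq
  have hs₂ := h₂.numNodes_eq
  obtain ⟨E, rfl, rfl⟩ := eq_graftLast_of_graftLast_eq hC hle
  obtain ⟨F, rfl, rfl⟩ := eq_graftLast_of_graftLast_eq hD (by omega)
  rw [numNodes_graftLast, numNodes_graftLast] at hs₂
  have hE : E.numNodes = 0 := by
    by_contra hne
    exact not_isNewPair_graftLast hs (by have := h.2.1; omega) (by omega) (by omega) h₂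
  obtain rfl := eq_nil_of_numNodes_eq_zero hE
  obtain rfl := eq_nil_of_numNodes_eq_zero (t := F) (by omega)
  have graftLast_nil_right (t : BTree) : Tamari.graftLast t nil = t := by
    induction t using BinaryTree.unitRecOn with
    | base => rfl
    | ind l r _ ih => rw [graftLast_node, ih]
  simp only [graftLast_nil_right, graftLast_nil, and_self]

/-! ### The quadratic method -/

section Algebra

open PowerSeries

/-- Exchange of the two variables of a power series with power series coefficients. -/
noncomputable def swapVars (R : Type*) [CommRing R] : R⟦X⟧⟦X⟧ →+* R⟦X⟧⟦X⟧ where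
  toFun f := mk fun i => mk fun j => coeff i (coeff j f)
  map_one' := by
    ext i j
    simp only [coeff_mk, coeff_one]
    split_ifs <;> simp_all [coeff_one]
  map_zero' := by ext; simp
  map_add' f g := by ext; simp
  map_mul' f g := by
    ext i j
    simp only [coeff_mk, coeff_mul, map_sum]
    exact Finset.sum_comm

theorem coeff_coeff_swapVars {R : Type*} [CommRing R] (f : R⟦X⟧⟦X⟧) (i j : ℕ) :
    coeff j (coeff i (swapVars R f)) = coeff i (coeff j f) := by
  simp [swapVars]

theorem swapVars_X {R : Type*} [CommRing R] : swapVars R X = C X := by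
  ext i j
  rw [coeff_coeff_swapVars, coeff_X, coeff_C]
  by_cases hi : i = 0 <;> by_cases hj : j = 1 <;> simp [hi, hj, coeff_one, coeff_X]

theorem swapVars_C_X {R : Type*} [CommRing R] : swapVars R (C X) = X := by
  ext i j
  rw [coeff_coeff_swapVars, coeff_X, coeff_C]
  by_cases hi : i = 1 <;> by_cases hj : j = 0 <;> simp [hi, hj, coeff_one, coeff_X]

theorem swapVars_map_C {R : Type*} [CommRing R] (f : R⟦X⟧) :
    swapVars R (map C f) = C f := by
  ext i j
  rw [coeff_coeff_swapVars, coeff_map, coeff_C, coeff_C]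
  by_cases hi : i = 0 <;> simp [hi]

/-- Brown's quadratic method: if a power series `D` in `u` over `ℚ⟦y⟧` which reduces modulo `y`
to a unit times `u` has a polynomial of degree at most three as its square, the latter has a double
root, hence discriminant zero. -/
theorem discrim_eq_zero_of_sq_eq {D : ℚ⟦X⟧⟦X⟧} {d0 d1 d2 d3 : ℚ⟦X⟧}
    (h0 : constantCoeff (constantCoeff D) = 0) (h1 : constantCoeff (coeff 1 D) ≠ 0)
    (hD : D ^ 2 = C d0 + C d1 * X + C d2 * X ^ 2 + C d3 * X ^ 3) :
    d1 ^ 2 * d2 ^ 2 - 4 * d0 * d2 ^ 3 - 4 * d1 ^ 3 * d3 - 27 * d0 ^ 2 * d3 ^ 2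
      + 18 * d0 * d1 * d2 * d3 = 0 := by
  have hm : IsLocalRing.maximalIdeal ℚ⟦X⟧ = Ideal.span {X} := PowerSeries.maximalIdeal_eq_span_X
  have : IsAdicComplete (IsLocalRing.maximalIdeal ℚ⟦X⟧) ℚ⟦X⟧ := by rw [hm]; infer_instance
  have hu : IsUnit (coeff 1 D) := by
    rw [isUnit_iff_constantCoeff]; exact isUnit_iff_ne_zero.2 h1
  have hc1 : coeff 1 (D.map (IsLocalRing.residue ℚ⟦X⟧)) ≠ 0 := by
    rw [coeff_map]
    exact (hu.map _).ne_zero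
  have hc0 : coeff 0 (D.map (IsLocalRing.residue ℚ⟦X⟧)) = 0 := by
    rw [coeff_map, IsLocalRing.residue_eq_zero_iff, hm, Ideal.mem_span_singleton, X_dvd_iff]
    simpa using h0
  have hne : D.map (IsLocalRing.residue ℚ⟦X⟧) ≠ 0 := fun h => hc1 (by rw [h]; simp)
  have hord : (D.map (IsLocalRing.residue ℚ⟦X⟧)).order = 1 := by
    rw [show (1 : ℕ∞) = ((1 : ℕ) : ℕ∞) from rfl, order_eq_nat]
    refine ⟨hc1, fun i hi => ?_⟩
    obtain rfl : i = 0 := by omega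
    exact hc0
  -- The Weierstrass polynomial of `D` has degree one, and its square divides `Δ` as a power series,
  -- hence as a polynomial.
  obtain ⟨f, h, H⟩ := exists_isWeierstrassFactorization hne
  have hdeg : f.natDegree = 1 := by
    rw [H.natDegree_eq_toNat_order_map, hord]; rfl
  have hf : f = Polynomial.X + Polynomial.C (f.coeff 0) :=
    H.isDistinguishedAt.monic.eq_X_add_C hdeg
  set a := f.coeff 0
  let Δ : Polynomial ℚ⟦X⟧ := Polynomial.C d0 + Polynomial.C d1 * Polynomial.X
    + Polynomial.C d2 * Polynomial.X ^ 2 + Polynomial.C d3 * Polynomial.X ^ 3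
  have hΔ : (Δ : ℚ⟦X⟧⟦X⟧) = D ^ 2 := by
    rw [hD]; simp [Δ]
  have hff := H.isDistinguishedAt.mul H.isDistinguishedAt
  have hffdeg : (f * f).natDegree = 2 := by
    rw [H.isDistinguishedAt.monic.natDegree_mul H.isDistinguishedAt.monic, hdeg]
  obtain ⟨q, hq, hqdeg⟩ : ∃ q : Polynomial ℚ⟦X⟧, Δ = f * f * q ∧ q.natDegree ≤ 1 := by
    have h3 : Δ.natDegree ≤ 3 := by
      simp only [Δ]; compute_degree
    refine ⟨Δ /ₘ (f * f), ?_, by rw [Polynomial.natDegree_divByMonic _ hff.monic]; omega⟩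
    have hdiv := Polynomial.modByMonic_add_div Δ (f * f)
    have hr : Δ %ₘ (f * f) = 0 := by
      refine (hff.isWeierstrassDivisorAt'.eq_zero_of_mul_eq
        (q := h * h - (Δ /ₘ (f * f) : Polynomial ℚ⟦X⟧)) ?_ ?_).2
      · have ho : ((f * f).natDegree : ℕ∞) = _ :=
          hff.coe_natDegree_eq_order_map (f * f : Polynomial ℚ⟦X⟧) 1 (by
            rw [constantCoeff_one, ← Ideal.ne_top_iff_one]
            exact Ideal.IsMaximal.ne_top inferInstance) (by simp)
        rw [← ho, ENat.toNat_natCast, ← Polynomial.degree_eq_natDegree hff.monic.ne_zero]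
        exact Polynomial.degree_modByMonic_lt _ hff.monic
      · have := congrArg (fun p : Polynomial ℚ⟦X⟧ => (p : ℚ⟦X⟧⟦X⟧)) hdiv
        simp only [Polynomial.coe_add, Polynomial.coe_mul, hΔ, H.eq_mul] at this ⊢
        linear_combination -this
    rw [hr, zero_add] at hdiv
    exact hdiv.symm
  obtain ⟨α, β, rfl⟩ := Polynomial.exists_eq_X_add_C_of_natDegree_le_one hqdeg
  have key : Δ = Polynomial.C (a ^ 2 * β) + Polynomial.C (2 * a * β + a ^ 2 * α) * Polynomial.X
      + Polynomial.C (β + 2 * a * α) * Polynomial.X ^ 2 + Polynomial.C α * Polynomial.X ^ 3 := by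
    rw [hq, hf]
    simp only [map_mul, map_add, map_pow, map_ofNat]
    ring
  have coeffs (b0 b1 b2 b3 : ℚ⟦X⟧) (i : ℕ) : (Polynomial.C b0 + Polynomial.C b1 * Polynomial.X
      + Polynomial.C b2 * Polynomial.X ^ 2 + Polynomial.C b3 * Polynomial.X ^ 3).coeff i
      = if i = 0 then b0 else if i = 1 then b1 else if i = 2 then b2 else
        if i = 3 then b3 else 0 := by
    rcases i with _ | _ | _ | _ | i <;>
      simp [Polynomial.coeff_X, Polynomial.coeff_C, Polynomial.coeff_X_pow]
  have hk (i : ℕ) := congrArg (fun p => Polynomial.coeff p i) key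
  simp only [Δ, coeffs] at hk
  have e0 : d0 = a ^ 2 * β := hk 0
  have e1 : d1 = 2 * a * β + a ^ 2 * α := hk 1
  have e2 : d2 = β + 2 * a * α := hk 2
  have e3 : d3 = α := hk 3
  rw [e0, e1, e2, e3]
  ring

/-- A functional equation with catalytic variable `x`, for a power series `V` in `y` with
polynomials in `x` as coefficients, yields a quadratic equation for `v`, the value of `V` at
`x = 1`. -/
theorem quadratic_of_catalytic {V : (Polynomial ℚ)⟦X⟧} {v : ℚ⟦X⟧}
    (hV : constantCoeff V = 0) (hv : constantCoeff v = 0)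
    (h : (C Polynomial.X - 1) * ((V - C Polynomial.X * X) * (1 - V))
      = X * C Polynomial.X ^ 2 * (V - map Polynomial.C v)) :
    16 * X * v ^ 2 + (1 - 12 * X - 8 * X ^ 2) * v - X + 11 * X ^ 2 + X ^ 3 = 0 := by
  -- Substitute `x = 1 + u` and regard `V` as a power series in `u` over `ℚ⟦y⟧`.
  let ev : Polynomial ℚ →+* ℚ⟦X⟧ := (Polynomial.aeval (1 + X : ℚ⟦X⟧)).toRingHom
  let θ : (Polynomial ℚ)⟦X⟧ →+* ℚ⟦X⟧⟦X⟧ := (swapVars ℚ).comp (map ev)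
  have heX : ev Polynomial.X = 1 + X := by simp [ev]
  have heC : ev.comp Polynomial.C = C := by
    ext1 r; simp [ev, Polynomial.aeval_C]
  have hθX : θ X = C X := by simp [θ, swapVars_X]
  have hθx : θ (C Polynomial.X) = 1 + X := by
    simp only [θ, RingHom.comp_apply, map_C, heX, map_add, map_one, swapVars_C_X]
  have hθv : θ (map Polynomial.C v) = C v := by
    simp only [θ, RingHom.comp_apply]
    rw [← RingHom.comp_apply (map ev), ← map_comp, heC, swapVars_map_C]
  have h' := congrArg θ h
  simp only [map_mul, map_sub, map_pow, map_one, hθX, hθx, hθv] at h'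
  set W := θ V with hW
  have hW0 (k : ℕ) : constantCoeff (coeff k W) = 0 := by
    rw [hW, ← coeff_zero_eq_constantCoeff_apply]
    simp only [θ, RingHom.comp_apply]
    rw [coeff_coeff_swapVars, coeff_map, coeff_zero_eq_constantCoeff_apply, hV]
    simp
  -- Completing the square in the equation, which is quadratic in `W`.
  have hdisc := discrim_eq_zero_of_sq_eq
    (D := 2 * X * W - (X - (1 + X) * C X))
    (d0 := X ^ 2) (d1 := -2 * X * (1 - X) + 4 * X * v)
    (d2 := (1 - X) ^ 2 - 4 * X + 8 * X * v) (d3 := -4 * X + 4 * X * v)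
    (by simp) (by
      have : coeff 1 (2 * X * W - (X - (1 + X) * C X))
          = 2 * coeff 0 W - (1 - (X : ℚ⟦X⟧)) := by
        have e : 2 * X * W - (X - (1 + X) * C X)
          = X * (C 2 * W - 1 + C (X : ℚ⟦X⟧)) + C X := by
          rw [map_ofNat]; ring
        have hs := coeff_succ_X_mul 0 (C 2 * W - 1 + C (X : ℚ⟦X⟧))
        rw [zero_add] at hs
        rw [e, map_add, hs]
        simp
        ring
      rw [this]
      have := hW0 0
      simp only [map_sub, map_mul, this]
      simp) (by
      simp only [map_mul, map_sub, map_add, map_pow, map_one, map_ofNat, map_neg]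
      linear_combination (-4 * X) * h')
  have hne : (16 * X ^ 2 * (v - 1) : ℚ⟦X⟧) ≠ 0 := by
    refine mul_ne_zero (mul_ne_zero ?_ (pow_ne_zero _ X_ne_zero)) fun h0 => ?_
    · have : CharZero ℚ⟦X⟧ := algebraRat.charZero _
      exact OfNat.ofNat_ne_zero 16
    · have := congrArg constantCoeff h0
      simp [hv] at this
  refine (mul_eq_zero.1 ?_).resolve_left hne
  linear_combination hdisc

/-- A quadratic equation over `ℚ⟦y⟧` whose discriminant is `(1 - 8 y) ^ 3` turns into a linear
differential equation, that is, a two-term recurrence on the coefficients. -/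
theorem coeff_recurrence_of_quadratic {ν : ℚ⟦X⟧}
    (h : 16 * ν ^ 2 - (-1 + 12 * X + 8 * X ^ 2) * ν - X ^ 2 + 11 * X ^ 3 + X ^ 4 = 0) (k : ℕ)
    (hk : 3 ≤ k) : ((k : ℚ) + 1) * coeff (k + 1) ν = (8 * k - 12) * coeff k ν := by
  set E : ℚ⟦X⟧ := 32 * ν + 1 - 12 * X - 8 * X ^ 2 with hE
  have hE2 : E ^ 2 = (1 - 8 * X) ^ 3 := by
    rw [hE]; linear_combination 64 * h
  have hd : (1 - 8 * X) * derivative ℚ E = -12 * E := by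
    have : CharZero ℚ⟦X⟧ := algebraRat.charZero _
    have hder := congrArg (derivative ℚ) hE2
    rw [Derivation.leibniz_pow, Derivation.leibniz_pow] at hder
    have h8 : derivative ℚ (1 - 8 * X : ℚ⟦X⟧) = -8 := by
      have : (8 : ℚ⟦X⟧) = C 8 := by rw [map_ofNat]
      rw [this, map_sub, Derivation.leibniz]
      simp
    rw [h8] at hder
    have hX : (1 - 8 * X : ℚ⟦X⟧) ≠ 0 := fun h0 => by
      have := congrArg constantCoeff h0
      simp at this
    -- Multiply the derivative of `E ^ 2 = (1 - 8 y) ^ 3` by `E` and cancel `2 (1 - 8 y) ^ 2`.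
    refine mul_left_cancel₀ (mul_ne_zero (OfNat.ofNat_ne_zero 2) (pow_ne_zero 2 hX)) ?_
    simp only [smul_eq_mul, nsmul_eq_mul, Nat.cast_ofNat, Nat.add_one_sub_one, pow_one] at hder
    linear_combination E * hder - 2 * derivative ℚ E * hE2
  have hEk (j : ℕ) (hj : 3 ≤ j) : coeff j E = 32 * coeff j ν := by
    have h12 : (12 : ℚ⟦X⟧) = C 12 := by rw [map_ofNat]
    have h32 : (32 : ℚ⟦X⟧) = C 32 := by rw [map_ofNat]
    have h8 : (8 : ℚ⟦X⟧) = C 8 := by rw [map_ofNat]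
    rw [hE, h12, h32, h8]
    simp only [map_sub, map_add, coeff_C_mul, coeff_one, coeff_X, coeff_X_pow]
    simp [show j ≠ 0 by omega, show j ≠ 1 by omega, show j ≠ 2 by omega]
  obtain ⟨k, rfl⟩ : ∃ i, k = i + 1 := ⟨k - 1, by omega⟩
  have hc := congrArg (coeff (k + 1)) hd
  have h8 : (1 - 8 * X) * derivative ℚ E
      = derivative ℚ E - C 8 * (X * derivative ℚ E) := by
    rw [map_ofNat]; ring
  have h12 : -12 * E = C (-12) * E := by
    rw [map_neg, map_ofNat]
  rw [h8, h12, map_sub, coeff_C_mul, coeff_C_mul, coeff_succ_X_mul, coeff_derivative,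
    coeff_derivative, hEk _ hk, hEk _ (by omega)] at hc
  push_cast at hc ⊢
  linear_combination hc / 32

end Algebra

open Finset.HasAntidiagonal (antidiagonal mem_antidiagonal)

/-! ### The generating function of new intervals -/

/-- The lower part, with `k` internal vertices, of the right border of a tree, together with the
left subtrees attached to it. -/
def takeSpine : ℕ → BTree → BTree
  | 0, _ => .nil
  | _ + 1, .nil => .nil
  | k + 1, .node _ l r => .node () l (takeSpine k r)

/-- The subtree whose root is the internal vertex number `k` of the right border of a tree. -/
def dropSpine : ℕ → BTree → BTree
  | 0, t => t
  | _ + 1, .nil => .nil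
  | k + 1, .node _ _ r => dropSpine k r

theorem graftLast_takeSpine_dropSpine (k : ℕ) (t : BTree) :
    graftLast (takeSpine k t) (dropSpine k t) = t := by
  induction k generalizing t with
  | zero => rfl
  | succ k ih =>
    cases t using BinaryTree.unitRecOn with
    | base => rfl
    | ind l r _ _ => rw [takeSpine, dropSpine, graftLast_node, ih]

theorem spine_takeSpine {k : ℕ} {t : BTree} (h : k ≤ spine t) : spine (takeSpine k t) = k := by
  induction k generalizing t with
  | zero => rfl
  | succ k ih =>
    cases t using BinaryTree.unitRecOn with
    | base => simp at h
    | ind l r _ _ =>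
      rw [spine_node] at h
      rw [takeSpine, spine_node, ih (by omega)]

theorem takeSpine_graftLast (X L : BTree) : takeSpine (spine X) (graftLast X L) = X := by
  induction X using BinaryTree.unitRecOn with
  | base => rfl
  | ind l r _ ih => rw [spine_node, graftLast_node, takeSpine, ih]

theorem dropSpine_graftLast (X L : BTree) : dropSpine (spine X) (graftLast X L) = L := by
  induction X using BinaryTree.unitRecOn with
  | base => rfl
  | ind l r _ ih => rw [spine_node, graftLast_node, dropSpine, ih]

theorem spine_pos_iff {t : BTree} : 1 ≤ spine t ↔ 1 ≤ t.numNodes := by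
  cases t using BinaryTree.unitRecOn with
  | base => simp
  | ind l r _ _ => simp

open Classical in
/-- The finite set of new intervals of `Y_n`, for `n ≥ 1`. -/
noncomputable def newPairs (n : ℕ) : Finset (BTree × BTree) :=
  (BinaryTree.treesOfNumNodesEq n ×ˢ BinaryTree.treesOfNumNodesEq n).filter
    fun p => IsNewPair p.1 p.2

theorem mem_newPairs {n : ℕ} {p : BTree × BTree} :
    p ∈ newPairs n ↔ IsNewPair p.1 p.2 ∧ p.2.numNodes = n := by
  simp only [newPairs, Finset.mem_filter, Finset.mem_product, BinaryTree.mem_treesOfNumNodesEq]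
  exact ⟨fun h => ⟨h.2, h.1.2⟩, fun h => ⟨⟨h.1.numNodes_eq.trans h.2, h.2⟩, h.1⟩⟩

theorem numNew_eq_card {n : ℕ} (hn : 1 ≤ n) : numNew n = (newPairs n).card := by
  rw [numNew, ← Nat.card_eq_finsetCard]
  refine Nat.card_congr
    { toFun := fun I => ⟨(I.1.fst.1, I.1.snd.1), mem_newPairs.2
        ⟨⟨I.1.fst_le_snd, hn.trans_eq I.1.snd.2.symm, (isNew_iff I.1).1 I.2⟩, I.1.snd.2⟩⟩
      invFun := fun p =>
        have hp := mem_newPairs.1 p.2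
        ⟨⟨⟨⟨p.1.1, hp.1.numNodes_eq.trans hp.2⟩, ⟨p.1.2, hp.2⟩⟩, hp.1.1⟩,
          (isNew_iff _).2 hp.1.2.2⟩
      left_inv := fun _ => rfl
      right_inv := fun _ => rfl }

/-- The polynomial counting new intervals of `Y_n` according to the length of the right border of
their minimum. -/
noncomputable def newPoly (n : ℕ) : Polynomial ℚ :=
  ∑ p ∈ newPairs n, Polynomial.X ^ spine p.1

theorem newPairs_zero : newPairs 0 = ∅ := by
  ext p
  simp only [mem_newPairs, Finset.notMem_empty, iff_false]
  rintro ⟨h, h₀⟩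
  have := h.2.1
  omega

theorem newPairs_one : newPairs 1 = {(nil △ nil, nil △ nil)} := by
  have eq_of_numNodes {t : BTree} (h : t.numNodes = 1) : t = nil △ nil := by
    cases t using BinaryTree.unitRecOn with
    | base => simp at h
    | ind l r _ _ =>
      simp only [BinaryTree.numNodes] at h
      rw [eq_nil_of_numNodes_eq_zero (t := l) (by omega),
        eq_nil_of_numNodes_eq_zero (t := r) (by omega)]
  ext ⟨S, T⟩
  simp only [mem_newPairs, Finset.mem_singleton, Prod.mk.injEq]
  constructor
  · rintro ⟨h, h₁⟩
    exact ⟨eq_of_numNodes (h.numNodes_eq.trans h₁), eq_of_numNodes h₁⟩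
  · rintro ⟨rfl, rfl⟩
    refine ⟨⟨.refl, by simp, ?_⟩, by simp⟩
    rintro ⟨S₀, T₀, R, R', i, h₁, h₂, h₃, h₄, h₅, h₆, -⟩
    have := congrArg BinaryTree.numNodes h₆
    rw [numNodes_graftAt _ h₅] at this
    simp at this
    omega

/-- The new intervals obtained by `IsNewPair.extend`. -/
def IsExtension (p : BTree × BTree) : Prop :=
  ∃ X L T, p = (graftLast X (L △ nil), T △ nil) ∧ IsNewPair (graftLast X L) T

open Classical in
/-- An extension of a new interval is determined by a vertex of the right border of its minimum. -/
theorem sum_filter_isExtension {n : ℕ} :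
    ∑ p ∈ (newPairs (n + 1)).filter IsExtension, (Polynomial.X : Polynomial ℚ) ^ spine p.1
      = ∑ p ∈ newPairs n, ∑ k ∈ Finset.range (spine p.1), Polynomial.X ^ (k + 2) := by
  rw [Finset.sum_sigma']
  symm
  refine Finset.sum_bij
    (fun q _ => (graftLast (takeSpine (q.2 + 1) q.1.1) (dropSpine (q.2 + 1) q.1.1 △ nil),
      q.1.2 △ nil)) ?_ ?_ ?_ ?_
  · rintro ⟨⟨S, T⟩, k⟩ h
    simp only [Finset.mem_sigma, mem_newPairs, Finset.mem_range] at h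
    obtain ⟨⟨h₁, h₂⟩, h₃⟩ := h
    have h₄ : IsNewPair (graftLast (takeSpine (k + 1) S) (dropSpine (k + 1) S)) T := by
      rwa [graftLast_takeSpine_dropSpine]
    rw [Finset.mem_filter, mem_newPairs]
    refine ⟨⟨h₄.extend ?_, by simp [h₂]⟩, ⟨_, _, _, rfl, h₄⟩⟩
    rw [← spine_pos_iff, spine_takeSpine (by omega)]
    omega
  · rintro ⟨⟨S, T⟩, k⟩ h ⟨⟨S', T'⟩, k'⟩ h' e
    simp only [Finset.mem_sigma, mem_newPairs, Finset.mem_range] at h h'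
    simp only [Prod.mk.injEq, BinaryTree.node.injEq, true_and, and_true] at e
    obtain ⟨e₁, rfl⟩ := e
    obtain ⟨e₂, e₃⟩ := graftLast_node_nil_inj e₁
    have hS : S = S' := by
      rw [← graftLast_takeSpine_dropSpine (k + 1) S, e₂, e₃, graftLast_takeSpine_dropSpine]
    have hk := congrArg spine e₂
    rw [spine_takeSpine (by omega), spine_takeSpine (by omega)] at hk
    obtain rfl : k = k' := by omega
    rw [hS]
  · rintro ⟨S, T⟩ h
    rw [Finset.mem_filter, mem_newPairs] at h
    obtain ⟨⟨h₁, h₂⟩, X, L, T₁, e, h₃⟩ := h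
    obtain ⟨rfl, rfl⟩ := Prod.mk.inj e
    have hX := spine_pos_iff.2 (h₁.one_le_of_extend h₃.2.1)
    have hk : spine X - 1 + 1 = spine X := by omega
    refine ⟨⟨(graftLast X L, T₁), spine X - 1⟩, ?_, ?_⟩
    · simp only [Finset.mem_sigma, mem_newPairs, Finset.mem_range]
      refine ⟨⟨h₃, by simpa using h₂⟩, ?_⟩
      rw [spine_graftLast]
      omega
    · simp only [hk, takeSpine_graftLast, dropSpine_graftLast]
  · rintro ⟨⟨S, T⟩, k⟩ h
    simp only [Finset.mem_sigma, mem_newPairs, Finset.mem_range] at h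
    simp only [spine_graftLast, spine_node, spine_nil]
    rw [spine_takeSpine (by omega)]

open Classical in
/-- The other new intervals correspond to pairs of new intervals, the second one having at least
two internal vertices. -/
theorem sum_filter_not_isExtension {n : ℕ} (hn : 1 ≤ n) :
    ∑ p ∈ (newPairs (n + 1)).filter (fun p => ¬ IsExtension p),
        (Polynomial.X : Polynomial ℚ) ^ spine p.1
      = ∑ ij ∈ (antidiagonal (n + 1)).filter (fun ij => ij.2 ≠ 1),
          newPoly ij.1 * newPoly ij.2 := by
  simp only [newPoly, Finset.sum_mul_sum, ← Finset.sum_product', ← pow_add]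
  rw [Finset.sum_sigma']
  symm
  refine Finset.sum_bij
    (fun q _ => (graftLast q.2.1.1 q.2.2.1, graftLast q.2.1.2 q.2.2.2.left △ nil)) ?_ ?_ ?_ ?_
  · rintro ⟨⟨i, j⟩, ⟨A, B⟩, ⟨C, D⟩⟩ h
    simp only [Finset.mem_sigma, Finset.mem_filter, mem_antidiagonal, Finset.mem_product,
      mem_newPairs] at h
    obtain ⟨⟨hij, hj⟩, ⟨hAB, hB⟩, hCD, hD⟩ := h
    obtain ⟨X, L, D, rfl, rfl, hle, -⟩ := isNewPair_iff.1 hCD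
    have hs := hle.numNodes_eq
    have hAB' := hAB.numNodes_eq
    have hB' := hAB.2.1
    simp only [BinaryTree.numNodes] at hD
    have hD₁ : 1 ≤ D.numNodes := by omega
    simp only [BinaryTree.left]
    rw [Finset.mem_filter, mem_newPairs]
    refine ⟨⟨hAB.graftLast hCD hD₁, ?_⟩, ?_⟩
    · simp only [numNodes_graftLast, BinaryTree.numNodes]; omega
    · rintro ⟨X', L', T', e, h'⟩
      obtain ⟨e₁, e₂⟩ := Prod.mk.inj e
      rw [← graftLast_assoc] at e₁
      obtain ⟨rfl, rfl⟩ := graftLast_node_nil_inj e₁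
      obtain ⟨rfl, -⟩ : graftLast B D = T' ∧ True := by simpa using e₂
      rw [graftLast_assoc] at h'
      exact not_isNewPair_graftLast hAB' (by omega) hs (by omega) h'
  · rintro ⟨⟨i, j⟩, ⟨A, B⟩, ⟨C, D⟩⟩ h ⟨⟨i', j'⟩, ⟨A', B'⟩, ⟨C', D'⟩⟩ h' e
    simp only [Finset.mem_sigma, Finset.mem_filter, mem_antidiagonal, Finset.mem_product,
      mem_newPairs] at h h'
    obtain ⟨-, ⟨hAB, hB⟩, hCD, hD⟩ := h
    obtain ⟨-, ⟨hAB', hB'⟩, hCD', hD'⟩ := h'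
    obtain ⟨_, _, E, -, rfl, -, -⟩ := isNewPair_iff.1 hCD
    obtain ⟨_, _, E', -, rfl, -, -⟩ := isNewPair_iff.1 hCD'
    simp only [Prod.mk.injEq, BinaryTree.node.injEq, true_and, and_true, BinaryTree.left] at e
    obtain ⟨rfl, rfl, rfl, rfl⟩ := hAB.graftLast_inj hAB' e.1 e.2
    obtain rfl := hB.symm.trans hB'
    obtain rfl := hD.symm.trans hD'
    rfl
  · rintro ⟨S, T⟩ h
    rw [Finset.mem_filter, mem_newPairs] at h
    obtain ⟨⟨h₁, h₂⟩, h₃⟩ := h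
    obtain ⟨X, L, T₁, rfl, rfl, -, -⟩ := isNewPair_iff.1 h₁
    simp only [BinaryTree.numNodes] at h₂
    obtain ⟨A, B, C, D, hAB, hCD, hD, e₁, rfl⟩ :=
      h₁.exists_graftLast (by omega) fun h => h₃ ⟨X, L, T₁, rfl, h⟩
    rw [numNodes_graftLast] at h₂
    refine ⟨⟨(B.numNodes, (D △ nil).numNodes), (A, B), (C, D △ nil)⟩, ?_, ?_⟩
    · simp only [Finset.mem_sigma, Finset.mem_filter, mem_antidiagonal,
        Finset.mem_product, mem_newPairs]
      refine ⟨⟨?_, ?_⟩, ⟨hAB, trivial⟩, hCD, trivial⟩ <;> simp only [BinaryTree.numNodes] <;> omega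
    · rw [e₁]
      rfl
  · rintro ⟨⟨i, j⟩, ⟨A, B⟩, ⟨C, D⟩⟩ _
    rw [spine_graftLast]

theorem newPoly_succ {n : ℕ} (hn : 1 ≤ n) : newPoly (n + 1) =
    ∑ p ∈ newPairs n, ∑ k ∈ Finset.range (spine p.1), Polynomial.X ^ (k + 2) +
      ∑ ij ∈ (antidiagonal (n + 1)).filter (fun ij => ij.2 ≠ 1),
        newPoly ij.1 * newPoly ij.2 := by
  classical
  rw [← sum_filter_isExtension, ← sum_filter_not_isExtension hn, newPoly,
    Finset.sum_filter_add_sum_filter_not]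

theorem newPoly_zero : newPoly 0 = 0 := by rw [newPoly, newPairs_zero, Finset.sum_empty]

theorem newPoly_one : newPoly 1 = Polynomial.X := by simp [newPoly, newPairs_one]

open PowerSeries in
/-- The functional equation satisfied by the generating function of new intervals, `x` being the
catalytic variable which records the length of the right border of the minimum. -/
theorem catalytic_equation :
    (C Polynomial.X - 1) * ((mk newPoly - C Polynomial.X * X) * (1 - mk newPoly))
      = X * C Polynomial.X ^ 2 *
        (mk newPoly - map Polynomial.C (mk fun n => ((newPairs n).card : ℚ))) := by
  set V : (Polynomial ℚ)⟦X⟧ := mk newPoly with hV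
  -- The summation of geometric progressions brings in the divided difference.
  have hsum (n : ℕ) : (Polynomial.X - 1) *
      ∑ p ∈ newPairs n, ∑ k ∈ Finset.range (spine p.1), (Polynomial.X : Polynomial ℚ) ^ (k + 2)
      = Polynomial.X ^ 2 * (newPoly n - Polynomial.C ((newPairs n).card : ℚ)) := by
    rw [newPoly, Finset.mul_sum, map_natCast, Finset.card_eq_sum_ones, Nat.cast_sum,
      ← Finset.sum_sub_distrib, Finset.mul_sum]
    refine Finset.sum_congr rfl fun p _ => ?_
    simp only [pow_add, ← Finset.sum_mul]
    rw [← mul_assoc, mul_geom_sum, Nat.cast_one]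
    ring
  -- `V - x y` counts the new intervals with at least two internal vertices.
  have hkey : V - C Polynomial.X * X = X * mk (fun n => ∑ p ∈ newPairs n,
      ∑ k ∈ Finset.range (spine p.1), Polynomial.X ^ (k + 2)) + V * (V - C Polynomial.X * X) := by
    have hW (j : ℕ) : coeff j (V - C Polynomial.X * X) = if j ≠ 1 then newPoly j else 0 := by
      rw [map_sub, coeff_C_mul, coeff_X, hV, coeff_mk]
      by_cases h : j = 1
      · simp [h, newPoly_one]
      · simp [h]
    ext1 n
    rw [map_add, coeff_mul n V, hW]
    simp only [hW]
    rcases n with _ | _ | n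
    · simp [hV, newPoly_zero]
    · rw [zero_add]
      have h₁ : coeff 1 ((X : (Polynomial ℚ)⟦X⟧) * mk (fun n => ∑ p ∈ newPairs n,
          ∑ k ∈ Finset.range (spine p.1), (Polynomial.X : Polynomial ℚ) ^ (k + 2))) = 0 := by
        have := coeff_succ_X_mul 0 (mk (fun n => ∑ p ∈ newPairs n,
          ∑ k ∈ Finset.range (spine p.1), (Polynomial.X : Polynomial ℚ) ^ (k + 2)))
        rw [zero_add] at this
        rw [this, coeff_mk, newPairs_zero, Finset.sum_empty]
      rw [h₁]
      simp [Finset.Nat.antidiagonal_succ, hV, newPoly_zero]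
    · rw [coeff_succ_X_mul, coeff_mk, if_pos (by omega), newPoly_succ (by omega),
        Finset.sum_filter]
      simp only [hV, coeff_mk, mul_ite, mul_zero]
  have hG : (C Polynomial.X - 1) * mk (fun n => ∑ p ∈ newPairs n,
      ∑ k ∈ Finset.range (spine p.1), (Polynomial.X : Polynomial ℚ) ^ (k + 2))
      = C Polynomial.X ^ 2 * (V - map Polynomial.C (mk fun n => ((newPairs n).card : ℚ))) := by
    have e₁ : (C (Polynomial.X : Polynomial ℚ) - 1) = C (Polynomial.X - 1) := by simp
    ext1 n
    rw [e₁, ← map_pow, coeff_C_mul, coeff_C_mul, coeff_mk, hsum, map_sub, coeff_map, hV, coeff_mk,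
      coeff_mk]
  linear_combination (C Polynomial.X - 1) * hkey + X * hG

open PowerSeries in
theorem nu_eq : nu = X * mk fun n => ((newPairs n).card : ℚ) := by
  ext n
  rcases n with _ | _ | n
  · simp [nu]
  · rw [coeff_succ_X_mul]
    simp [nu, newPairs_zero]
  · rw [coeff_succ_X_mul]
    simp [nu, numNew_eq_card]

open PowerSeries in
theorem nu_quadratic : 16 * nu ^ 2 - (-1 + 12 * X + 8 * X ^ 2) * nu - X ^ 2 + 11 * X ^ 3 + X ^ 4
    = 0 := by
  have h := quadratic_of_catalytic (by simp [newPoly_zero]) (by simp [newPairs_zero])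
    catalytic_equation
  rw [nu_eq]
  linear_combination X * h

theorem numNew_recurrence {n : ℕ} (hn : 2 ≤ n) :
    ((n : ℚ) + 2) * numNew (n + 1) = 4 * (2 * n - 1) * numNew n := by
  have h := coeff_recurrence_of_quadratic nu_quadratic (n + 1) (by omega)
  rw [nu, PowerSeries.coeff_mk, PowerSeries.coeff_mk, if_pos (by omega), if_pos (by omega)] at h
  push_cast at h
  linear_combination h

theorem numNew_two : (numNew 2 : ℚ) = 1 := by
  have h : newPoly 2 = Polynomial.X ^ 2 := by
    rw [newPoly_succ le_rfl, newPairs_one]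
    simp [Finset.sum_filter, Finset.Nat.antidiagonal_succ, newPoly_zero]
  have h₁ := congrArg (Polynomial.eval 1) h
  rw [newPoly, Polynomial.eval_finsetSum] at h₁
  rw [numNew_eq_card (by omega)]
  simpa using h₁

theorem numNew_formula {n : ℕ} (hn : 2 ≤ n) : (numNew n : ℚ) =
    3 * ((2 ^ (n - 2) * (2 * n - 2)! : ℕ) : ℚ) / (((n - 1)! * (n + 1)! : ℕ) : ℚ) := by
  induction n, hn using Nat.le_induction with
  | base => rw [numNew_two]; norm_num [Nat.factorial]
  | succ n hn ih =>
    have h := numNew_recurrence hn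
    obtain ⟨m, rfl⟩ := Nat.exists_eq_add_of_le hn
    rw [ih] at h
    -- Truncated subtractions have to be evaluated before casting to `ℚ`.
    have e₁ : 2 + m + 1 - 2 = m + 1 := by omega
    have e₂ : 2 * (2 + m + 1) - 2 = 2 * m + 2 + 1 + 1 := by omega
    have e₃ : 2 + m + 1 - 1 = m + 1 + 1 := by omega
    have e₄ : 2 + m + 1 + 1 = m + 1 + 1 + 1 + 1 := by omega
    have e₅ : 2 + m - 2 = m := by omega
    have e₆ : 2 * (2 + m) - 2 = 2 * m + 2 := by omega
    have e₇ : 2 + m - 1 = m + 1 := by omega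
    have e₈ : 2 + m + 1 = m + 1 + 1 + 1 := by omega
    rw [e₅, e₆, e₇, e₈] at h
    rw [e₁, e₂, e₃, e₄, e₈]
    have hm : ((2 + m : ℕ) : ℚ) + 2 ≠ 0 := by positivity
    refine mul_left_cancel₀ hm (h.trans ?_)
    rw [Nat.factorial_succ (m + 1 + 1 + 1), Nat.factorial_succ (m + 1),
      Nat.factorial_succ (2 * m + 2 + 1), Nat.factorial_succ (2 * m + 2), pow_succ]
    have hf₁ : ((m + 1)! : ℚ) ≠ 0 := by positivity
    have hf₂ : ((m + 1 + 1 + 1)! : ℚ) ≠ 0 := by positivity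
    push_cast
    field_simp
    ring

end Tamari

theorem mainTheorem2 :
    (∀ n : ℕ, 2 ≤ n →
      (Tamari.numNew n : ℚ) =
        3 * ((2 ^ (n - 2) * (2 * n - 2)! : ℕ) : ℚ) / (((n - 1)! * (n + 1)! : ℕ) : ℚ)) ∧
    16 * Tamari.nu ^ 2
        - (-1 + 12 * PowerSeries.X + 8 * PowerSeries.X ^ 2) * Tamari.nu
        - PowerSeries.X ^ 2 + 11 * PowerSeries.X ^ 3 + PowerSeries.X ^ 4 = 0 := by
  exact ⟨fun _ hn => Tamari.numNew_formula hn, Tamari.nu_quadratic⟩
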